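/- **Theorem 1.** Let $\mathbb{T}^d=(\mathbb{R}/\mathbb{Z})^d$ and $L^2_0(\mathbb{T}^d)=\{\theta\in L^2(\mathbb{T}^d):\int\theta\,dx=0\}$. For a flow $u\in L^\infty_{loc}([0,\infty)\times\mathbb{T}^d;\mathbb{R}^d)$ with $\nabla\cdot u=0$ (in the sense of distributions), a diffusivity $\nu>0$ and times $0\le s\le t<\infty$, let $\Phi^{u,\nu}_{s,t}:L^2_0(\mathbb{T}^d)\to L^2_0(\mathbb{T}^d)$ denote the solution operator of $$\partial_t\theta-\nu\Delta\theta+u\cdot\nabla\theta=0,$$ so that $\theta(t)=\Phi^{u,\nu}_{s,t}\theta_0$ is the weak solution, in $C([s,T];L^2_0)\cap L^2(s,T;H^1)$ for every $T>s$, with $\theta(s)=\theta_0$. Let $$\tau^u(\nu)=\sup_{s\ge 0}\,\inf\{t-s:\ t\ge s,\ \|\Phi^{u,\nu}_{s,t}\|_{L^2_0\to L^2_0}\le \tfrac12\}\in[0,\infty],$$ and call $u$ *relaxation enhancing* if $\nu\,\tau^u(\nu)\to 0$ as $\nu\to 0^+$. Suppose that $u\in L^\infty_{loc}([0,\infty)\times\mathbb{T}^d;\mathbb{R}^d)$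 is divergence-free and relaxation enhancing. Then there is an increasing $C^\infty$ diffeomorphism $\sigma:[0,1)\to[0,\infty)$ such that, for the accelerated flow $u_\sigma(t,x)=\sigma'(t)\,u(\sigma(t),x)$ on $[0,1)\times\mathbb{T}^d$, for all $\nu>0$, all $s\in[0,1)$ and all $\theta_0\in L^2_0(\mathbb{T}^d)$, $$\Phi^{u_\sigma,\nu}_{s,1}\theta_0=0 .$$ That is: the equation $\partial_t\theta-\nu\Delta\theta+u_\sigma\cdot\nabla\theta=0$ has a weak solution on $[s,1)$, in $C([s,T];L^2_0)\cap L^2(s,T;H^1)$ for every $T\in(s,1)$, with $\theta(s)=\theta_0$, and every such solution satisfies $\theta(t)\to0$ in $L^2(\mathbb{T}^d)$ as $t\to1^-$. -/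

import Mathlib

open MeasureTheory Filter Topology Set
open scoped ENNReal ContDiff InnerProductSpace

namespace RelaxEnh

/-- The flat torus `𝕋^d = (ℝ/ℤ)^d`. -/
abbrev Torus (d : ℕ) : Type := UnitAddTorus (Fin d)

/-- The measure `dx` on the torus, of total mass one (the product of the Haar probability
measures of the circles, as in Mathlib's Fourier analysis on the torus). -/
noncomputable abbrev dx (d : ℕ) : Measure (Torus d) :=
  Measure.pi (fun _ => AddCircle.haarAddCircle)

/-- The Euclidean space `ℝ^d` in which the flow takes its values. -/
abbrev Vec (d : ℕ) : Type := EuclideanSpace ℝ (Fin d)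

/-- `ψ ∈ C^∞(𝕋^d)`: the `ℤ^d`-periodic lift of `ψ` to `ℝ^d` is smooth. -/
def SmoothTorus {d : ℕ} (ψ : Torus d → ℝ) : Prop :=
  ContDiff ℝ ∞ (fun y : Fin d → ℝ => ψ (fun i => (y i : UnitAddCircle)))

/-- The partial derivative `∂_i ψ` on the torus. -/
noncomputable def pderiv {d : ℕ} (i : Fin d) (ψ : Torus d → ℝ) (x : Torus d) : ℝ :=
  deriv (fun h : ℝ => ψ (x + Pi.single i (h : UnitAddCircle))) 0

/-- The gradient `∇ψ` on the torus. -/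
noncomputable def grad {d : ℕ} (ψ : Torus d → ℝ) (x : Torus d) : Vec d :=
  WithLp.toLp 2 (fun i => pderiv i ψ x)

/-- `g` is the distributional gradient of `f` on the torus. -/
def HasWeakGrad {d : ℕ} (f : Torus d → ℝ) (g : Torus d → Vec d) : Prop :=
  ∀ ψ : Torus d → ℝ, SmoothTorus ψ → ∀ i : Fin d,
    ∫ x, f x * pderiv i ψ x ∂(dx d) = - ∫ x, g x i * ψ x ∂(dx d)

/-- `L²_0(𝕋^d)`: the mean-zero functions in `L²(𝕋^d)`. -/
noncomputable def L20 (d : ℕ) : Submodule ℝ (Lp ℝ 2 (dx d)) where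
  carrier := {θ | ∫ x, θ x ∂(dx d) = 0}
  zero_mem' := by
    show ∫ x, (0 : Lp ℝ 2 (dx d)) x ∂(dx d) = 0
    rw [integral_congr_ae (Lp.coeFn_zero ℝ 2 (dx d))]
    simp
  add_mem' := by
    intro a b ha hb
    have ia : Integrable a (dx d) := (Lp.memLp a).integrable (by norm_num)
    have ib : Integrable b (dx d) := (Lp.memLp b).integrable (by norm_num)
    show ∫ x, (a + b) x ∂(dx d) = 0
    rw [integral_congr_ae (Lp.coeFn_add a b)]
    simp only [Pi.add_apply]
    rw [integral_add ia ib]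
    have ha' : ∫ x, a x ∂(dx d) = 0 := ha
    have hb' : ∫ x, b x ∂(dx d) = 0 := hb
    rw [ha', hb', add_zero]
  smul_mem' := by
    intro c a ha
    show ∫ x, (c • a) x ∂(dx d) = 0
    rw [integral_congr_ae (Lp.coeFn_smul c a)]
    have ha' : ∫ x, a x ∂(dx d) = 0 := ha
    simp only [Pi.smul_apply, integral_smul, ha', smul_zero]

/-- `u ∈ L^∞_loc([0,∞) × 𝕋^d)`. Values at negative times play no role. -/
def LocBounded {d : ℕ} (u : ℝ → Torus d → Vec d) : Prop :=
  ∀ T : ℝ, MemLp (fun p : ℝ × Torus d => u p.1 p.2) ∞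
    ((volume.restrict (Icc 0 T)).prod (dx d))

/-- `∇ · u = 0` on `[0,∞) × 𝕋^d`, in the sense of distributions. -/
def DivFree {d : ℕ} (u : ℝ → Torus d → Vec d) : Prop :=
  ∀ᵐ t ∂(volume.restrict (Ici (0 : ℝ))), ∀ ψ : Torus d → ℝ, SmoothTorus ψ →
    ∫ x, ⟪u t x, grad ψ x⟫_ℝ ∂(dx d) = 0

/-- `θ ∈ C([s,T]; L²_0) ∩ L²(s,T; H¹)` is a weak solution on `[s,T] × 𝕋^d` of
`∂_t θ - ν Δθ + u · ∇θ = 0`; here `g` is `∇θ`. -/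
def IsSolution {d : ℕ} (u : ℝ → Torus d → Vec d) (ν s T : ℝ) (θ : ℝ → L20 d) : Prop :=
  ContinuousOn θ (Icc s T) ∧
  ∃ g : ℝ → Torus d → Vec d,
    MemLp (fun p : ℝ × Torus d => g p.1 p.2) 2
      ((volume.restrict (Icc s T)).prod (dx d)) ∧
    (∀ᵐ t ∂(volume.restrict (Icc s T)), HasWeakGrad (θ t).1 (g t)) ∧
    ∀ ψ : Torus d → ℝ, SmoothTorus ψ → ∀ t ∈ Icc s T,
      (∫ x, (θ t).1 x * ψ x ∂(dx d)) - (∫ x, (θ s).1 x * ψ x ∂(dx d)) =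
        ∫ r in s..t, ∫ x, (- ν * ⟪g r x, grad ψ x⟫_ℝ - ⟪u r x, g r x⟫_ℝ * ψ x) ∂(dx d)

/-- The graph of the solution operator `Φ^{u,ν}_{s,t} : L²_0 → L²_0`, that is
`Φ^{u,ν}_{s,t} θ₀ = θ₁`. -/
def PhiEq {d : ℕ} (u : ℝ → Torus d → Vec d) (ν s t : ℝ) (θ₀ θ₁ : L20 d) : Prop :=
  ∃ θ : ℝ → L20 d, IsSolution u ν s t θ ∧ θ s = θ₀ ∧ θ t = θ₁

/-- `‖Φ^{u,ν}_{s,t}‖_{L²_0 → L²_0} ≤ c`. -/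
def PhiNormLe {d : ℕ} (u : ℝ → Torus d → Vec d) (ν s t c : ℝ) : Prop :=
  ∀ θ₀ θ₁ : L20 d, PhiEq u ν s t θ₀ θ₁ → ‖θ₁‖ ≤ c * ‖θ₀‖

/-- The dissipation time
`τ^u(ν) = sup_{s ≥ 0} inf {t - s : t ≥ s, ‖Φ^{u,ν}_{s,t}‖ ≤ 1/2}`, with values in `[0,∞]`. -/
noncomputable def dissipationTime {d : ℕ} (u : ℝ → Torus d → Vec d) (ν : ℝ) : ℝ≥0∞ :=
  ⨆ s ∈ Ici (0 : ℝ), ⨅ t ∈ {t : ℝ | s ≤ t ∧ PhiNormLe u ν s t (1 / 2)}, ENNReal.ofReal (t - s)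

/-- `u` is relaxation enhancing: `ν τ^u(ν) → 0` as `ν → 0+`. -/
def RelaxationEnhancing {d : ℕ} (u : ℝ → Torus d → Vec d) : Prop :=
  Tendsto (fun ν : ℝ => ENNReal.ofReal ν * dissipationTime u ν) (𝓝[>] 0) (𝓝 0)

/-- `σ` restricts to an increasing `C^∞` diffeomorphism of `[0,1)` onto `[0,∞)`. -/
def IsIncreasingDiffeo (σ : ℝ → ℝ) : Prop :=
  BijOn σ (Ico 0 1) (Ici 0) ∧ StrictMonoOn σ (Ico 0 1) ∧ ContDiffOn ℝ ∞ σ (Ico 0 1) ∧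
    ∃ ρ : ℝ → ℝ, InvOn ρ σ (Ico 0 1) (Ici 0) ∧ ContDiffOn ℝ ∞ ρ (Ici 0)

/-- The accelerated flow `u_σ(t,x) = σ'(t) u(σ(t),x)`, for `t ∈ [0,1)`. -/
noncomputable def accelerate {d : ℕ} (σ : ℝ → ℝ) (u : ℝ → Torus d → Vec d) :
    ℝ → Torus d → Vec d :=
  fun t x => derivWithin σ (Ico 0 1) t • u (σ t) x

/-- `Φ^{v,ν}_{s,1} θ₀ = 0`, for a flow `v` on `[0,1) × 𝕋^d` that may be singular at time `1`:
the equation has a solution on `[s,1)` with initial datum `θ₀`, and every such solution tends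
to `0` in `L²` as `t → 1`. -/
def DissipatesTotally {d : ℕ} (v : ℝ → Torus d → Vec d) (ν s : ℝ) (θ₀ : L20 d) : Prop :=
  (∃ θ : ℝ → L20 d, (∀ T ∈ Ico s 1, IsSolution v ν s T θ) ∧ θ s = θ₀) ∧
  ∀ θ : ℝ → L20 d, (∀ T ∈ Ico s 1, IsSolution v ν s T θ) → θ s = θ₀ →
    Tendsto θ (𝓝[<] 1) (𝓝 0)

end RelaxEnh

/-! The key is a scaling. Where `σ' = l` is constant, the time change `y = σ(t)` turns the
accelerated equation with diffusivity `ν` into the equation for `u` with diffusivity `ν / l`, and an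
interval of length `δ` into one of length `l δ`. Relaxation enhancement makes `(ν / l) τ^u(ν / l)`
small for large `l`, so `τ^u(ν / l) < l δ` as soon as this product is below `ν δ`. One slope serves
all `ν` in `[1/n, n]` at once, which is why a single `σ` works for every diffusivity.

Take disjoint intervals `[startTime n, endTime n]` accumulating at `1`, let `σ` be affine on the
`n`-th with such a slope `lam n` (`exists_slope`, `exists_clock`), and interpolate smoothly in the
gaps. For given `ν`, every interval with `n ≥ max(ν, 1/ν)` halves the `L²` norm
(`IsSolution.timeChange`, `norm_endTime_le`). In the gaps the norm does not increase, so infinitely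
many halvings give decay to `0` (`tendsto_zero_of_halving`).

The rest is the theory of weak solutions for bounded divergence-free flows, done in a real Fourier
basis. Each mode solves a scalar linear ODE with the transport term as forcing. Summing the mode
energies gives `IsSolution.norm_le`, because `∫ (v · ∇θ) θ = 0` for divergence-free `v`; uniqueness
follows. Existence (`exists_solution`) is a contraction argument for the transport term, made to
work on the whole time interval by an added damping `μ`. The accelerated flow is bounded only on
compact subintervals of `[0,1)`, so solutions there are glued by uniqueness. -/

namespace RelaxEnh

/-! ### Calculus of smooth functions on the torus and a real Fourier basis. -/

section TorusCalculus

variable {d : ℕ}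

/-- The covering map `ℝ^d → 𝕋^d`. -/
def cover (d : ℕ) (y : Fin d → ℝ) : Torus d := fun i => (y i : UnitAddCircle)

lemma isOpenQuotientMap_cover : IsOpenQuotientMap (cover d) :=
  IsOpenQuotientMap.piMap (fun _ => QuotientAddGroup.isOpenQuotientMap_mk)

lemma cover_add_single (y : Fin d → ℝ) (i : Fin d) (h : ℝ) :
    cover d y + Pi.single i (h : UnitAddCircle) = cover d (y + h • Pi.single i 1) := by
  funext j
  by_cases hj : j = i
  · subst hj; simp [cover]
  · simp [cover, hj]

lemma SmoothTorus.continuous {ψ : Torus d → ℝ} (hψ : SmoothTorus ψ) : Continuous ψ :=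
  isOpenQuotientMap_cover.isQuotientMap.continuous_iff.2 (ContDiff.continuous hψ)

lemma SmoothTorus.hasDerivAt_cover {ψ : Torus d → ℝ} (hψ : SmoothTorus ψ) (i : Fin d)
    (y : Fin d → ℝ) : HasDerivAt (fun h : ℝ => ψ (cover d y + Pi.single i (h : UnitAddCircle)))
      (fderiv ℝ (fun y => ψ (cover d y)) y (Pi.single i 1)) 0 := by
  simp_rw [cover_add_single]
  have h1 : HasDerivAt (fun h : ℝ => y + h • (Pi.single i (1 : ℝ) : Fin d → ℝ))
      (Pi.single i 1) 0 := by
    simpa using ((hasDerivAt_id (0 : ℝ)).smul_const (Pi.single i (1 : ℝ) : Fin d → ℝ)).const_add y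
  have h2 : HasFDerivAt (fun y => ψ (cover d y)) (fderiv ℝ (fun y => ψ (cover d y)) y)
      (y + (0 : ℝ) • (Pi.single i (1 : ℝ) : Fin d → ℝ)) := by
    rw [zero_smul, add_zero]
    exact ((ContDiff.differentiable hψ (by simp)) y).hasFDerivAt
  exact h2.comp_hasDerivAt (0 : ℝ) h1

lemma SmoothTorus.pderiv_cover {ψ : Torus d → ℝ} (hψ : SmoothTorus ψ) (i : Fin d)
    (y : Fin d → ℝ) : pderiv i ψ (cover d y) =
      fderiv ℝ (fun y => ψ (cover d y)) y (Pi.single i 1) :=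
  (hψ.hasDerivAt_cover i y).deriv

lemma SmoothTorus.pderiv {ψ : Torus d → ℝ} (hψ : SmoothTorus ψ) (i : Fin d) :
    SmoothTorus (pderiv i ψ) := by
  have : (fun y : Fin d → ℝ => RelaxEnh.pderiv i ψ (fun i => (y i : UnitAddCircle))) =
      fun y => fderiv ℝ (fun y => ψ (cover d y)) y (Pi.single i 1) :=
    funext fun y => hψ.pderiv_cover i y
  unfold SmoothTorus
  rw [this]
  exact (ContDiff.fderiv_right (m := ∞) hψ (by simp)).clm_apply contDiff_const

lemma SmoothTorus.hasDerivAt_zero {ψ : Torus d → ℝ} (hψ : SmoothTorus ψ) (i : Fin d)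
    (x : Torus d) : HasDerivAt (fun h : ℝ => ψ (x + Pi.single i (h : UnitAddCircle)))
      (RelaxEnh.pderiv i ψ x) 0 := by
  obtain ⟨y, rfl⟩ := isOpenQuotientMap_cover.surjective x
  rw [hψ.pderiv_cover]
  exact hψ.hasDerivAt_cover i y

lemma SmoothTorus.hasDerivAt {ψ : Torus d → ℝ} (hψ : SmoothTorus ψ) (i : Fin d)
    (x : Torus d) (h : ℝ) : HasDerivAt (fun h : ℝ => ψ (x + Pi.single i (h : UnitAddCircle)))
      (RelaxEnh.pderiv i ψ (x + Pi.single i (h : UnitAddCircle))) h := by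
  have h1 := hψ.hasDerivAt_zero i (x + Pi.single i (h : UnitAddCircle))
  have h2 : HasDerivAt (fun h' : ℝ => h' - h) 1 h := (hasDerivAt_id h).sub_const h
  have h3 := HasDerivAt.comp h (h₂ := fun h' : ℝ => ψ (x + Pi.single i (h : UnitAddCircle) +
    Pi.single i (h' : UnitAddCircle))) (h := fun h' : ℝ => h' - h)
    (h₂' := RelaxEnh.pderiv i ψ (x + Pi.single i (h : UnitAddCircle))) (by simpa using h1) h2
  rw [mul_one] at h3
  refine h3.congr_of_eventuallyEq (Eventually.of_forall fun h' => ?_)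
  simp only [Function.comp]
  rw [add_assoc, ← Pi.single_add, ← AddCircle.coe_add]
  congr 4
  ring

lemma SmoothTorus.mul {ψ φ : Torus d → ℝ} (hψ : SmoothTorus ψ) (hφ : SmoothTorus φ) :
    SmoothTorus (fun x => ψ x * φ x) := ContDiff.mul hψ hφ

lemma pderiv_mul {ψ φ : Torus d → ℝ} (hψ : SmoothTorus ψ) (hφ : SmoothTorus φ) (i : Fin d)
    (x : Torus d) :
    pderiv i (fun x => ψ x * φ x) x = pderiv i ψ x * φ x + ψ x * pderiv i φ x := by
  have := ((hψ.hasDerivAt_zero i x).mul (hφ.hasDerivAt_zero i x)).deriv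
  simpa [pderiv] using! this

lemma SmoothTorus.integrable {ψ : Torus d → ℝ} (hψ : SmoothTorus ψ) : Integrable ψ (dx d) :=
  hψ.continuous.integrable_of_hasCompactSupport (HasCompactSupport.of_compactSpace ψ)

lemma _root_.Continuous.memLp_dx {ψ : Torus d → ℝ} (hψ : Continuous ψ) (p : ℝ≥0∞) :
    MemLp ψ p (dx d) := by
  obtain ⟨C, hC⟩ := isCompact_univ.exists_bound_of_continuousOn hψ.continuousOn
  exact MemLp.of_bound hψ.aestronglyMeasurable C (Eventually.of_forall fun x => hC x (mem_univ x))

/-- Differentiation under the integral sign of a quantity constant in `h`. With `F h` the translate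
of a function by `h`, translation invariance makes the integral of a partial derivative vanish. -/
lemma integral_eq_zero_of_hasDerivAt {X : Type*} [MeasurableSpace X] {μ : Measure X}
    [IsFiniteMeasure μ] {F F' : ℝ → X → ℝ} {C c : ℝ} (hF : ∀ h, AEStronglyMeasurable (F h) μ)
    (hF0 : Integrable (F 0) μ) (hF' : AEStronglyMeasurable (F' 0) μ) (hC : ∀ h x, ‖F' h x‖ ≤ C)
    (hd : ∀ x h, HasDerivAt (fun h => F h x) (F' h x) h) (hc : ∀ h, ∫ x, F h x ∂μ = c) :
    ∫ x, F' 0 x ∂μ = 0 := by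
  have key := (hasDerivAt_integral_of_dominated_loc_of_deriv_le (μ := μ)
    (F := F) (F' := F') (x₀ := (0 : ℝ)) (bound := fun _ => C) (s := univ) univ_mem
    (Eventually.of_forall hF) hF0 hF'
    (Eventually.of_forall fun x h _ => hC h x) (integrable_const C)
    (Eventually.of_forall fun x h _ => hd x h)).2
  simp_rw [hc] at key
  exact key.unique (hasDerivAt_const (0 : ℝ) c)

/-- Translation of the torus by `h` in the direction `i`. -/
def shift (i : Fin d) (h : ℝ) (x : Torus d) : Torus d := x + Pi.single i (h : UnitAddCircle)

lemma continuous_shift (i : Fin d) (h : ℝ) : Continuous (shift i h) :=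
  continuous_id.add continuous_const

lemma shift_zero (i : Fin d) (x : Torus d) : shift i 0 x = x := by
  simp [shift]

lemma integral_shift (i : Fin d) (h : ℝ) (ψ : Torus d → ℝ) :
    ∫ x, ψ (shift i h x) ∂(dx d) = ∫ x, ψ x ∂(dx d) :=
  integral_add_right_eq_self (μ := dx d) ψ (Pi.single i (h : UnitAddCircle))

/-- The integral of a partial derivative over the torus vanishes. -/
lemma integral_pderiv {ψ : Torus d → ℝ} (hψ : SmoothTorus ψ) (i : Fin d) :
    ∫ x, pderiv i ψ x ∂(dx d) = 0 := by
  obtain ⟨C, hC⟩ := isCompact_univ.exists_bound_of_continuousOn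
    (hψ.pderiv i).continuous.continuousOn
  have h0 : Integrable (fun x => ψ (shift i 0 x)) (dx d) := by
    simp only [shift_zero]
    exact hψ.integrable
  have key := integral_eq_zero_of_hasDerivAt (μ := dx d)
    (F := fun (h : ℝ) (x : Torus d) => ψ (shift i h x))
    (F' := fun (h : ℝ) (x : Torus d) => pderiv i ψ (shift i h x))
    (C := C) (c := ∫ x, ψ x ∂(dx d))
    (fun h => (hψ.continuous.comp (continuous_shift i h)).aestronglyMeasurable) h0
    ((hψ.pderiv i).continuous.comp (continuous_shift i 0)).aestronglyMeasurable
    (fun h x => hC _ (mem_univ _)) (fun x h => hψ.hasDerivAt i x h)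
    (fun h => integral_shift i h ψ)
  simpa only [shift_zero] using key

lemma integral_pderiv_mul {ψ φ : Torus d → ℝ} (hψ : SmoothTorus ψ) (hφ : SmoothTorus φ)
    (i : Fin d) : ∫ x, pderiv i ψ x * φ x ∂(dx d) = - ∫ x, ψ x * pderiv i φ x ∂(dx d) := by
  have h := integral_pderiv (hψ.mul hφ) i
  simp_rw [pderiv_mul hψ hφ] at h
  rw [integral_add ((hψ.pderiv i).mul hφ).integrable (hψ.mul (hφ.pderiv i)).integrable] at h
  linarith

/-! ### The Hartley basis -/

/-- The Hartley function `cos (2π k·x) + sin (2π k·x)`. -/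
noncomputable def cas (k : Fin d → ℤ) (x : Torus d) : ℝ :=
  (UnitAddTorus.mFourier k x).re + (UnitAddTorus.mFourier k x).im

lemma mFourier_cover (k : Fin d → ℤ) (y : Fin d → ℝ) :
    UnitAddTorus.mFourier k (cover d y) =
      Complex.exp ((2 * Real.pi * ∑ i, (k i : ℝ) * y i : ℝ) * Complex.I) := by
  simp only [UnitAddTorus.mFourier, cover, ContinuousMap.coe_mk, fourier_coe_apply]
  rw [← Complex.exp_sum]
  congr 1
  push_cast
  rw [Finset.mul_sum, Finset.sum_mul]
  refine Finset.sum_congr rfl fun i _ => ?_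
  simp
  ring

lemma cas_cover (k : Fin d → ℤ) (y : Fin d → ℝ) :
    cas k (cover d y) = Real.cos (2 * Real.pi * ∑ i, (k i : ℝ) * y i) +
      Real.sin (2 * Real.pi * ∑ i, (k i : ℝ) * y i) := by
  rw [cas, mFourier_cover, Complex.exp_ofReal_mul_I_re, Complex.exp_ofReal_mul_I_im]

lemma smoothTorus_cas (k : Fin d → ℤ) : SmoothTorus (cas k) := by
  have : (fun y : Fin d → ℝ => cas k (fun i => (y i : UnitAddCircle))) =
      fun y => Real.cos (2 * Real.pi * ∑ i, (k i : ℝ) * y i) +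
      Real.sin (2 * Real.pi * ∑ i, (k i : ℝ) * y i) := funext fun y => cas_cover k y
  unfold SmoothTorus
  rw [this]
  fun_prop

/-- The derivative of `cos + sin` is `cos - sin`, the Hartley function of `-k`. Hence gradients
couple the modes `k` and `-k`, and sums over modes are reindexed by `Equiv.neg` below. -/
lemma pderiv_cas (i : Fin d) (k : Fin d → ℤ) (x : Torus d) :
    pderiv i (cas k) x = 2 * Real.pi * k i * cas (-k) x := by
  obtain ⟨y, rfl⟩ := isOpenQuotientMap_cover.surjective x
  have hlin : ∀ h : ℝ, ∑ j, (k j : ℝ) * (y + h • (Pi.single i (1 : ℝ) : Fin d → ℝ)) j =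
      ∑ j, (k j : ℝ) * y j + h * k i := by
    intro h
    simp [mul_add, Finset.sum_add_distrib, Pi.single_apply, mul_comm]
  have h0 : HasDerivAt (fun h : ℝ => 2 * Real.pi * (∑ j, (k j : ℝ) * y j + h * k i))
      (2 * Real.pi * k i) 0 := by
    simpa using (((hasDerivAt_id (0 : ℝ)).mul_const (k i : ℝ)).const_add
      (∑ j, (k j : ℝ) * y j)).const_mul (2 * Real.pi)
  have h1 := (h0.cos.add h0.sin).deriv
  have h2 : (fun h : ℝ => cas k (cover d y + Pi.single i (h : UnitAddCircle))) =
      (fun h : ℝ => Real.cos (2 * Real.pi * (∑ j, (k j : ℝ) * y j + h * k i))) +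
      fun h : ℝ => Real.sin (2 * Real.pi * (∑ j, (k j : ℝ) * y j + h * k i)) := by
    funext h
    rw [cover_add_single, cas_cover, hlin]
    rfl
  rw [pderiv, h2, h1, cas_cover]
  simp [Finset.sum_neg_distrib]
  ring

lemma integral_mFourier (k : Fin d → ℤ) :
    ∫ x, UnitAddTorus.mFourier k x ∂(dx d) = if k = 0 then 1 else 0 := by
  have h := orthonormal_iff_ite.1 (UnitAddTorus.orthonormal_mFourier (d := Fin d)) 0 k
  rw [ContinuousMap.inner_toLp] at h
  simp only [UnitAddTorus.mFourier_zero, ContinuousMap.one_apply, map_one, mul_one] at h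
  refine h.trans ?_
  simp [eq_comm]

/-- From `(cos a + sin a)(cos b + sin b) = cos (a - b) + sin (a + b)`: the sine always integrates to
zero, and the cosine does unless `k = l`. -/
lemma integral_cas_mul_cas (k l : Fin d → ℤ) :
    ∫ x, cas k x * cas l x ∂(dx d) = if k = l then 1 else 0 := by
  have hc : ∀ m : Fin d → ℤ, Integrable (fun x => UnitAddTorus.mFourier m x) (dx d) := fun m =>
    (UnitAddTorus.mFourier m).continuous.integrable_of_hasCompactSupport
      (HasCompactSupport.of_compactSpace _)
  have h1 : ∀ x, cas k x * cas l x = (UnitAddTorus.mFourier (k + -l) x).re +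
      (UnitAddTorus.mFourier (k + l) x).im := by
    intro x
    rw [UnitAddTorus.mFourier_add, UnitAddTorus.mFourier_add, UnitAddTorus.mFourier_neg, cas, cas]
    simp
    ring
  simp_rw [h1]
  have h5 : Integrable (fun x => (UnitAddTorus.mFourier (k + -l) x).re) (dx d) := (hc _).re
  have h6 : Integrable (fun x => (UnitAddTorus.mFourier (k + l) x).im) (dx d) := (hc _).im
  rw [integral_add h5 h6]
  have h2 := integral_re (𝕜 := ℂ) (hc (k + -l))
  have h3 := integral_im (𝕜 := ℂ) (hc (k + l))
  simp only [RCLike.re_to_complex, RCLike.im_to_complex] at h2 h3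
  rw [h2, h3, integral_mFourier, integral_mFourier]
  have h4 : k + -l = 0 ↔ k = l := by rw [← sub_eq_add_neg, sub_eq_zero]
  simp only [h4]
  split_ifs <;> simp

/-- The Hartley functions as elements of `L²`. -/
noncomputable def casLp (k : Fin d → ℤ) : Lp ℝ 2 (dx d) :=
  ((smoothTorus_cas k).continuous.memLp_dx 2).toLp (cas k)

lemma coeFn_casLp (k : Fin d → ℤ) : casLp k =ᵐ[dx d] cas k := MemLp.coeFn_toLp _

lemma orthonormal_casLp : Orthonormal ℝ (casLp (d := d)) := by
  classical
  rw [orthonormal_iff_ite]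
  intro k l
  rw [L2.inner_def, ← integral_cas_mul_cas]
  refine integral_congr_ae ?_
  filter_upwards [coeFn_casLp k, coeFn_casLp l] with x hk hl
  simp [hk, hl, mul_comm]

/-- The real and imaginary parts of an exponential are combinations of `cas k` and `cas (-k)`, so
all complex Fourier coefficients vanish and completeness of the exponentials applies. -/
lemma eq_zero_of_integral_mul_cas (f : Lp ℝ 2 (dx d))
    (h : ∀ k, ∫ x, f x * cas k x ∂(dx d) = 0) : f = 0 := by
  have hf := Lp.memLp f
  have hcos : ∀ (k : Fin d → ℤ) x, (UnitAddTorus.mFourier k x).re =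
      (1 / 2) * cas k x + (1 / 2) * cas (-k) x := by
    intro k x
    simp only [cas, UnitAddTorus.mFourier_neg, Complex.conj_re, Complex.conj_im]
    ring
  have hsin : ∀ (k : Fin d → ℤ) x, (UnitAddTorus.mFourier k x).im =
      (1 / 2) * cas k x - (1 / 2) * cas (-k) x := by
    intro k x
    simp only [cas, UnitAddTorus.mFourier_neg, Complex.conj_re, Complex.conj_im]
    ring
  have hi : ∀ k, Integrable (fun x => f x * cas k x) (dx d) := fun k =>
    hf.integrable_mul ((smoothTorus_cas k).continuous.memLp_dx 2)
  have hF : MemLp (fun x => (f x : ℂ)) 2 (dx d) := hf.ofReal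
  have hcoef : ∀ k, UnitAddTorus.mFourierCoeff (d := Fin d) (hF.toLp _) k = 0 := by
    intro k
    have : UnitAddTorus.mFourierCoeff (d := Fin d) (hF.toLp _) k =
        ∫ x, (((1 / 2) * (f x * cas (-k) x) + (1 / 2) * (f x * cas k x) : ℝ) : ℂ) +
          (((1 / 2) * (f x * cas (-k) x) - (1 / 2) * (f x * cas k x) : ℝ) : ℂ) * Complex.I
          ∂(dx d) := by
      refine integral_congr_ae ?_
      filter_upwards [hF.coeFn_toLp] with x hx
      rw [hx, smul_eq_mul]
      have e : UnitAddTorus.mFourier (-k) x = ((UnitAddTorus.mFourier (-k) x).re : ℂ) +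
          ((UnitAddTorus.mFourier (-k) x).im : ℂ) * Complex.I := (Complex.re_add_im _).symm
      rw [e, hcos, hsin, neg_neg]
      push_cast
      ring
    rw [this, integral_add, integral_mul_const, integral_complex_ofReal, integral_complex_ofReal,
      integral_add, integral_sub]
    · simp_rw [integral_const_mul, h]
      simp
    all_goals first
      | exact (hi _).const_mul _
      | exact (((hi _).const_mul _).add ((hi _).const_mul _)).ofReal
      | exact (((hi _).const_mul _).sub ((hi _).const_mul _)).ofReal.mul_const _
  have h0 : hF.toLp _ = 0 := by
    refine (UnitAddTorus.mFourierBasis (d := Fin d)).repr.injective ?_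
    ext k
    rw [UnitAddTorus.mFourierBasis_repr, hcoef]
    simp
  have h1 : (fun x => (f x : ℂ)) =ᵐ[dx d] 0 := by
    refine hF.coeFn_toLp.symm.trans ?_
    rw [h0]
    exact Lp.coeFn_zero _ _ _
  refine (Lp.eq_zero_iff_ae_eq_zero).2 ?_
  filter_upwards [h1] with x hx
  simpa using hx

/-- The Hartley basis of the real Hilbert space `L²(𝕋^d)`. -/
noncomputable def hartley (d : ℕ) : HilbertBasis (Fin d → ℤ) ℝ (Lp ℝ 2 (dx d)) :=
  HilbertBasis.mkOfOrthogonalEqBot orthonormal_casLp <| by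
    rw [Submodule.eq_bot_iff]
    intro f hf
    refine eq_zero_of_integral_mul_cas f fun k => ?_
    have := (Submodule.mem_orthogonal _ f).1 hf _ (Submodule.subset_span (mem_range_self k))
    rw [L2.inner_def] at this
    rw [← this]
    refine integral_congr_ae ?_
    filter_upwards [coeFn_casLp k] with x hx
    simp [hx]

lemma coe_hartley : ⇑(hartley d) = casLp := HilbertBasis.coe_mkOfOrthogonalEqBot _ _

end TorusCalculus

lemma _root_.MeasureTheory.MemLp.integrable_fun_mul {X : Type*} [MeasurableSpace X] {μ : Measure X}
    {f g : X → ℝ} (hf : MemLp f 2 μ) (hg : MemLp g 2 μ) : Integrable (fun x => f x * g x) μ :=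
  hf.integrable_mul hg

/-! ### Weak gradients and divergence-free fields in terms of coefficients. -/

section Sobolev

variable {d : ℕ}

/-- The Hartley coefficients of a function on the torus. -/
noncomputable def coef (f : Torus d → ℝ) (k : Fin d → ℤ) : ℝ := ∫ x, f x * cas k x ∂(dx d)

lemma memLp_cas (k : Fin d → ℤ) (p : ℝ≥0∞) : MemLp (cas k) p (dx d) :=
  (smoothTorus_cas k).continuous.memLp_dx p

lemma SmoothTorus.memLp {ψ : Torus d → ℝ} (hψ : SmoothTorus ψ) (p : ℝ≥0∞) : MemLp ψ p (dx d) :=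
  hψ.continuous.memLp_dx p

lemma coef_congr {f g : Torus d → ℝ} (h : f =ᵐ[dx d] g) (k : Fin d → ℤ) : coef f k = coef g k :=
  integral_congr_ae (h.mono fun x hx => by simp only [hx])

lemma inner_hartley_eq_coef (f : Lp ℝ 2 (dx d)) (k : Fin d → ℤ) :
    ⟪f, hartley d k⟫_ℝ = coef f k := by
  rw [coe_hartley, L2.inner_def]
  refine integral_congr_ae ?_
  filter_upwards [coeFn_casLp k] with x hx
  simp [hx, mul_comm]

lemma hasSum_coef_mul_coef {f g : Torus d → ℝ} (hf : MemLp f 2 (dx d)) (hg : MemLp g 2 (dx d)) :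
    HasSum (fun k => coef f k * coef g k) (∫ x, f x * g x ∂(dx d)) := by
  have h := (hartley d).hasSum_inner_mul_inner (hf.toLp f) (hg.toLp g)
  have h1 : ∀ k, ⟪hf.toLp f, hartley d k⟫_ℝ * ⟪hartley d k, hg.toLp g⟫_ℝ =
      coef f k * coef g k := by
    intro k
    rw [real_inner_comm (hg.toLp g), inner_hartley_eq_coef, inner_hartley_eq_coef,
      coef_congr hf.coeFn_toLp, coef_congr hg.coeFn_toLp]
  simp_rw [h1] at h
  convert! h using 1
  rw [L2.inner_def]
  refine integral_congr_ae ?_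
  filter_upwards [hf.coeFn_toLp, hg.coeFn_toLp] with x hx hx'
  simp [hx, hx', mul_comm]

lemma coef_sub {f g : Torus d → ℝ} (hf : MemLp f 2 (dx d)) (hg : MemLp g 2 (dx d))
    (k : Fin d → ℤ) : coef (fun x => f x - g x) k = coef f k - coef g k := by
  simp only [coef, sub_mul]
  exact integral_sub (hf.integrable_fun_mul (memLp_cas k 2)) (hg.integrable_fun_mul (memLp_cas k 2))

lemma coef_const_mul (c : ℝ) (f : Torus d → ℝ) (k : Fin d → ℤ) :
    coef (fun x => c * f x) k = c * coef f k := by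
  simp only [coef, mul_assoc]
  exact integral_const_mul c _

lemma ae_eq_of_coef_eq {f g : Torus d → ℝ} (hf : MemLp f 2 (dx d)) (hg : MemLp g 2 (dx d))
    (h : ∀ k, coef f k = coef g k) : f =ᵐ[dx d] g := by
  have h0 := eq_zero_of_integral_mul_cas ((hf.sub hg).toLp _) fun k => by
    have h1 := coef_congr (hf.sub hg).coeFn_toLp k
    have h2 := coef_sub hf hg k
    rw [h k, sub_self] at h2
    exact h1.trans h2
  have h1 := (hf.sub hg).coeFn_toLp
  rw [h0] at h1
  filter_upwards [h1, Lp.coeFn_zero ℝ 2 (dx d)] with x hx hx'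
  rw [hx'] at hx
  exact (sub_eq_zero.1 hx.symm)

/-- Mean-zero functions have vanishing zeroth coefficient, and conversely. -/
lemma coef_zero (f : Torus d → ℝ) : coef f 0 = ∫ x, f x ∂(dx d) := by
  simp [coef, cas, UnitAddTorus.mFourier_zero]

lemma SmoothTorus.hasWeakGrad {ψ : Torus d → ℝ} (hψ : SmoothTorus ψ) :
    HasWeakGrad ψ (grad ψ) := fun φ hφ i => by
  have := integral_pderiv_mul hψ hφ i
  simp only [grad]
  linarith

lemma HasWeakGrad.coef_eq {f : Torus d → ℝ} {g : Torus d → Vec d} (h : HasWeakGrad f g)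
    (i : Fin d) (k : Fin d → ℤ) :
    coef (fun x => g x i) k = -(2 * Real.pi * k i) * coef f (-k) := by
  have := h _ (smoothTorus_cas k) i
  simp only [pderiv_cas] at this
  have h2 : ∫ x, f x * (2 * Real.pi * k i * cas (-k) x) ∂(dx d) =
      (2 * Real.pi * k i) * coef f (-k) := by
    rw [coef, ← integral_const_mul]
    exact integral_congr_ae (Eventually.of_forall fun x => by ring)
  rw [h2] at this
  simp only [coef] at this ⊢
  linarith

lemma SmoothTorus.coef_pderiv {ψ : Torus d → ℝ} (hψ : SmoothTorus ψ) (i : Fin d)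
    (k : Fin d → ℤ) : coef (RelaxEnh.pderiv i ψ) k = -(2 * Real.pi * k i) * coef ψ (-k) :=
  hψ.hasWeakGrad.coef_eq i k

/-- Converse of `HasWeakGrad.coef_eq`: Parseval reduces an arbitrary smooth test function to the
basis functions. -/
lemma hasWeakGrad_of_coef {f : Torus d → ℝ} {g : Torus d → Vec d} (hf : MemLp f 2 (dx d))
    (hg : ∀ i, MemLp (fun x => g x i) 2 (dx d))
    (h : ∀ i k, coef (fun x => g x i) k = -(2 * Real.pi * k i) * coef f (-k)) :
    HasWeakGrad f g := by
  intro ψ hψ i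
  have h1 := hasSum_coef_mul_coef hf ((hψ.pderiv i).memLp 2)
  have h2 := (hasSum_coef_mul_coef (hg i) (hψ.memLp 2)).neg
  rw [← (Equiv.neg (Fin d → ℤ)).hasSum_iff] at h2
  refine h1.unique (h2.congr_fun fun k => ?_)
  simp [h, hψ.coef_pderiv]
  ring

/-- The product rule, obtained by using `φ * ψ` as test function for `f`. -/
lemma HasWeakGrad.mul_smooth {f φ : Torus d → ℝ} {g : Torus d → Vec d} (h : HasWeakGrad f g)
    (hf : MemLp f 2 (dx d)) (hg : ∀ i, MemLp (fun x => g x i) 2 (dx d)) (hφ : SmoothTorus φ) :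
    HasWeakGrad (fun x => f x * φ x) (fun x => φ x • g x + f x • grad φ x) := by
  intro ψ hψ i
  have h1 := h _ (hφ.mul hψ) i
  simp only [pderiv_mul hφ hψ] at h1
  have e1 : ∀ x, f x * (pderiv i φ x * ψ x + φ x * pderiv i ψ x) =
      f x * (pderiv i φ x * ψ x) + f x * (φ x * pderiv i ψ x) := fun x => by ring
  simp only [e1] at h1
  rw [integral_add (hf.integrable_fun_mul (((hφ.pderiv i).mul hψ).memLp 2))
    (hf.integrable_fun_mul ((hφ.mul (hψ.pderiv i)).memLp 2))] at h1
  have e2 : ∀ x, (φ x • g x + f x • grad φ x) i * ψ x =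
      g x i * (φ x * ψ x) + f x * (pderiv i φ x * ψ x) := fun x => by
    simp [grad]; ring
  simp only [e2]
  rw [integral_add ((hg i).integrable_fun_mul ((hφ.mul hψ).memLp 2))
    (hf.integrable_fun_mul (((hφ.pderiv i).mul hψ).memLp 2))]
  simp only [mul_assoc]
  linarith

/-- A vector field on the torus whose distributional divergence vanishes. -/
def WeakDivFree (v : Torus d → Vec d) : Prop :=
  ∀ ψ : Torus d → ℝ, SmoothTorus ψ → ∫ x, ⟪v x, grad ψ x⟫_ℝ ∂(dx d) = 0

lemma integral_inner_eq_sum {v g : Torus d → Vec d} (hv : ∀ i, MemLp (fun x => v x i) 2 (dx d))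
    (hg : ∀ i, MemLp (fun x => g x i) 2 (dx d)) :
    ∫ x, ⟪v x, g x⟫_ℝ ∂(dx d) = ∑ i, ∫ x, v x i * g x i ∂(dx d) := by
  rw [← integral_finsetSum _ fun i _ => (hv i).integrable_fun_mul (hg i)]
  refine integral_congr_ae (Eventually.of_forall fun x => ?_)
  simp [PiLp.inner_apply, mul_comm]

lemma WeakDivFree.sum_coef {v : Torus d → Vec d} (h : WeakDivFree v)
    (hv : ∀ i, MemLp (fun x => v x i) 2 (dx d)) (k : Fin d → ℤ) :
    ∑ i, 2 * Real.pi * k i * coef (fun x => v x i) k = 0 := by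
  have h1 := h _ (smoothTorus_cas (-k))
  rw [integral_inner_eq_sum hv fun i => ((smoothTorus_cas (-k)).pderiv i).memLp 2] at h1
  have : ∀ i, ∫ x, v x i * grad (cas (-k)) x i ∂(dx d) =
      -(2 * Real.pi * k i * coef (fun x => v x i) k) := by
    intro i
    rw [coef, ← integral_const_mul, ← integral_neg]
    refine integral_congr_ae (Eventually.of_forall fun x => ?_)
    simp [grad, pderiv_cas]
    ring
  simp_rw [this, Finset.sum_neg_distrib] at h1
  linarith

/-- Extends the divergence condition from smooth test functions to weak gradients. Mode by mode, the
coefficient vector of `g` is parallel to `k` and that of `v` is orthogonal to `k`. -/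
lemma WeakDivFree.integral_inner_eq_zero {v g : Torus d → Vec d} {w : Torus d → ℝ}
    (h : WeakDivFree v) (hv : ∀ i, MemLp (fun x => v x i) 2 (dx d))
    (hg : ∀ i, MemLp (fun x => g x i) 2 (dx d)) (hw : HasWeakGrad w g) :
    ∫ x, ⟪v x, g x⟫_ℝ ∂(dx d) = 0 := by
  rw [integral_inner_eq_sum hv hg]
  have h1 := hasSum_sum fun i (_ : i ∈ Finset.univ) => hasSum_coef_mul_coef (hv i) (hg i)
  refine h1.unique (hasSum_zero.congr_fun fun k => ?_)
  have h2 := h.sum_coef hv k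
  have : ∀ i, coef (fun x => v x i) k * coef (fun x => g x i) k =
      -coef w (-k) * (2 * Real.pi * k i * coef (fun x => v x i) k) := fun i => by
    rw [hw.coef_eq]; ring
  simp_rw [this, ← Finset.mul_sum, h2, mul_zero]

/-- For a bounded divergence-free field `v` and `w ∈ H¹`, `∫ (v · ∇w) w = 0`. -/
lemma WeakDivFree.integral_inner_mul_eq_zero {v g : Torus d → Vec d} {w : Torus d → ℝ}
    (h : WeakDivFree v) (hv : ∀ i, MemLp (fun x => v x i) ∞ (dx d))
    (hg : ∀ i, MemLp (fun x => g x i) 2 (dx d)) (hwm : MemLp w 2 (dx d))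
    (hw : HasWeakGrad w g) :
    ∫ x, ⟪v x, g x⟫_ℝ * w x ∂(dx d) = 0 := by
  have hv2 : ∀ i, MemLp (fun x => v x i) 2 (dx d) := fun i => (hv i).mono_exponent le_top
  have hvw : ∀ i, MemLp (fun x => v x i * w x) 2 (dx d) := fun i =>
    MemLp.mul' (p := ∞) (q := 2) hwm (hv i)
  have hvg : ∀ i, MemLp (fun x => v x i * g x i) 2 (dx d) := fun i =>
    MemLp.mul' (p := ∞) (q := 2) (hg i) (hv i)
  have hin : ∀ x, ⟪v x, g x⟫_ℝ = ∑ i, v x i * g x i := fun x => by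
    simp [PiLp.inner_apply, mul_comm]
  have hvgs : MemLp (fun x => ⟪v x, g x⟫_ℝ) 2 (dx d) := by
    simp_rw [hin]
    exact memLp_finsetSum _ fun i _ => hvg i
  -- The identity `v · ∇w = ∇ · (v w)` in coefficients, from the divergence condition tested against
  -- `w * cas k`. Only `v w ∈ L²` is needed, so boundedness of `v` suffices.
  have hk : ∀ k, coef (fun x => ⟪v x, g x⟫_ℝ) k =
      -∑ i, 2 * Real.pi * k i * coef (fun x => v x i * w x) (-k) := by
    intro k
    have hc := smoothTorus_cas k
    have hφg : ∀ i, MemLp (fun x => cas k x * g x i) 2 (dx d) := fun i =>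
      MemLp.mul' (p := ∞) (q := 2) (hg i) (hc.memLp ∞)
    have hwφ : ∀ i, MemLp (fun x => w x * pderiv i (cas k) x) 2 (dx d) := fun i =>
      MemLp.mul' (p := 2) (q := ∞) ((hc.pderiv i).memLp ∞) hwm
    have hz := h.integral_inner_eq_zero (w := fun x => w x * cas k x)
      (g := fun x => cas k x • g x + w x • grad (cas k) x) hv2
      (fun i => by simpa [grad] using! (hφg i).add (hwφ i)) (hw.mul_smooth hwm hg hc)
    have e : ∀ x, ⟪v x, cas k x • g x + w x • grad (cas k) x⟫_ℝ = ⟪v x, g x⟫_ℝ * cas k x +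
        ∑ i, 2 * Real.pi * k i * (v x i * w x * cas (-k) x) := by
      intro x
      rw [inner_add_right, inner_smul_right, inner_smul_right]
      simp only [PiLp.inner_apply, grad, pderiv_cas]
      rw [mul_comm (cas k x), Finset.mul_sum]
      congr 1
      refine Finset.sum_congr rfl fun i _ => ?_
      simp
      ring
    simp only [e] at hz
    rw [integral_add (hvgs.integrable_fun_mul (memLp_cas k 2))
      (integrable_finsetSum _ fun i _ => ((hvw i).integrable_fun_mul (memLp_cas (-k) 2)).const_mul _),
      integral_finsetSum _ fun i _ => ((hvw i).integrable_fun_mul (memLp_cas (-k) 2)).const_mul _] at hz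
    simp_rw [integral_const_mul] at hz
    simp only [coef]
    linarith
  -- By Parseval, `hk` turns the integral into minus `∑ i, ∫ (v_i w) g_i`, which is the same
  -- integral again: it equals its own negative.
  have h1 := hasSum_coef_mul_coef hvgs hwm
  have h2 := (hasSum_sum fun i (_ : i ∈ Finset.univ) => hasSum_coef_mul_coef (hvw i) (hg i)).neg
  rw [← (Equiv.neg (Fin d → ℤ)).hasSum_iff] at h2
  have h3 := h1.unique (h2.congr_fun fun k => ?_)
  · have h4 : ∫ x, ⟪v x, g x⟫_ℝ * w x ∂(dx d) = ∑ i, ∫ x, v x i * w x * g x i ∂(dx d) := by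
      rw [← integral_finsetSum _ fun i _ => (hvw i).integrable_fun_mul (hg i)]
      refine integral_congr_ae (Eventually.of_forall fun x => ?_)
      simp only [hin, Finset.sum_mul]
      exact Finset.sum_congr rfl fun i _ => by ring
    linarith
  · rw [hk]
    simp only [Function.comp, Equiv.neg_apply, hw.coef_eq, neg_neg]
    rw [neg_mul, Finset.sum_mul]
    congr 1
    refine Finset.sum_congr rfl fun i _ => ?_
    simp
    ring

end Sobolev

/-! ### Absolutely continuous functions and the damped scalar ODE. -/

section Primitive

/-- On `[s,T]` the function `y` is a primitive of the integrable function `h`. -/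
structure IsPrimitive (y h : ℝ → ℝ) (s T : ℝ) : Prop where
  integrable : IntervalIntegrable h volume s T
  eq : ∀ t ∈ Icc s T, y t = y s + ∫ r in s..t, h r

variable {y z h k f : ℝ → ℝ} {s T t a c : ℝ}

lemma IsPrimitive.integrable_to (H : IsPrimitive y h s T) (ht : t ∈ Icc s T) :
    IntervalIntegrable h volume s t :=
  H.integrable.mono_set (by
    rw [uIcc_of_le ht.1, uIcc_of_le (ht.1.trans ht.2)]; exact Icc_subset_Icc_right ht.2)

lemma IsPrimitive.mono (H : IsPrimitive y h s T) (ht : t ∈ Icc s T) : IsPrimitive y h s t :=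
  ⟨H.integrable_to ht, fun r hr => H.eq r ⟨hr.1, hr.2.trans ht.2⟩⟩

lemma IsPrimitive.continuousOn (H : IsPrimitive y h s T) : ContinuousOn y (Icc s T) := by
  rcases le_or_gt s T with hsT | hsT
  · have h1 := intervalIntegral.continuousOn_primitive_interval' H.integrable left_mem_uIcc
    rw [uIcc_of_le hsT] at h1
    exact (continuousOn_const.add h1).congr fun t ht => H.eq t ht
  · simp [hsT]

/-- Integration by parts for absolutely continuous functions. The derivatives are known only almost
everywhere, as `h` and `k` are merely integrable. -/
lemma IsPrimitive.integral_mul (hsT : s ≤ T) (H : IsPrimitive y h s T)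
    (K : IsPrimitive z k s T) :
    y T * z T = y s * z s + ∫ r in s..T, (h r * z r + y r * k r) := by
  have hT : T ∈ Icc s T := right_mem_Icc.2 hsT
  have acy := H.integrable.absolutelyContinuousOnInterval_intervalIntegral
    (c := s) left_mem_uIcc
  have acz := K.integrable.absolutelyContinuousOnInterval_intervalIntegral
    (c := s) left_mem_uIcc
  have cst : ∀ c : ℝ, AbsolutelyContinuousOnInterval (fun _ : ℝ => c) s T := fun c =>
    contDiffOn_const.absolutelyContinuousOnInterval
  have key := ((cst (y s)).fun_add acy).integral_deriv_mul_eq_sub ((cst (z s)).fun_add acz)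
  simp only [intervalIntegral.integral_same, add_zero] at key
  rw [← H.eq T hT, ← K.eq T hT] at key
  have h2 : ∫ x in s..T, (h x * z x + y x * k x) = y T * z T - y s * z s := by
    rw [← key]
    refine intervalIntegral.integral_congr_ae ?_
    filter_upwards [H.integrable.ae_hasDerivAt_integral, K.integrable.ae_hasDerivAt_integral]
      with x hx hx' hxm
    have hxm' := uIoc_subset_uIcc hxm
    rw [((hx hxm' s left_mem_uIcc).const_add (y s)).deriv,
      ((hx' hxm' s left_mem_uIcc).const_add (z s)).deriv]
    rw [uIcc_of_le hsT] at hxm'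
    rw [← H.eq x hxm', ← K.eq x hxm']
  rw [h2]
  ring

lemma IsPrimitive.mul (hsT : s ≤ T) (H : IsPrimitive y h s T) (K : IsPrimitive z k s T) :
    IsPrimitive (fun r => y r * z r) (fun r => h r * z r + y r * k r) s T := by
  refine ⟨?_, fun t ht => (H.mono ht).integral_mul ht.1 (K.mono ht)⟩
  refine (H.integrable.mul_continuousOn ?_).add (K.integrable.continuousOn_mul ?_)
  · rw [uIcc_of_le hsT]; exact K.continuousOn
  · rw [uIcc_of_le hsT]; exact H.continuousOn

lemma isPrimitive_exp (s T a : ℝ) :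
    IsPrimitive (fun r => Real.exp (a * (r - s))) (fun r => a * Real.exp (a * (r - s))) s T := by
  have hd : ∀ r : ℝ, HasDerivAt (fun r => Real.exp (a * (r - s))) (a * Real.exp (a * (r - s))) r :=
    fun r => by
      have h1 : HasDerivAt (fun r => a * (r - s)) a r := by
        simpa using ((hasDerivAt_id r).sub_const s).const_mul a
      simpa [mul_comm] using h1.exp
  have hi : ∀ t, IntervalIntegrable (fun r => a * Real.exp (a * (r - s))) volume s t := fun t =>
    Continuous.intervalIntegrable (by fun_prop) _ _
  refine ⟨hi T, fun t _ => ?_⟩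
  rw [intervalIntegral.integral_eq_sub_of_hasDerivAt (fun r _ => hd r) (hi t)]
  ring

/-- The solution of `y' = -a y + f`, `y(s) = c`. -/
noncomputable def duhamel (a s c : ℝ) (f : ℝ → ℝ) (t : ℝ) : ℝ :=
  (c + ∫ r in s..t, Real.exp (a * (r - s)) * f r) * Real.exp (-a * (t - s))

lemma duhamel_self (a s c : ℝ) (f : ℝ → ℝ) : duhamel a s c f s = c := by simp [duhamel]

/-- The product rule applied to an integral and the integrating factor; the two exponentials cancel
in the forcing term. -/
lemma isPrimitive_duhamel (hsT : s ≤ T) (a c : ℝ) (hf : IntervalIntegrable f volume s T) :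
    IsPrimitive (duhamel a s c f) (fun r => -a * duhamel a s c f r + f r) s T := by
  have h1 : IsPrimitive (fun t => c + ∫ r in s..t, Real.exp (a * (r - s)) * f r)
      (fun r => Real.exp (a * (r - s)) * f r) s T :=
    ⟨hf.continuousOn_mul (by fun_prop), fun t _ => by simp⟩
  have h2 := h1.mul hsT (isPrimitive_exp s T (-a))
  have e : ∀ r, Real.exp (a * (r - s)) * f r * Real.exp (-a * (r - s)) +
      (c + ∫ r in s..r, Real.exp (a * (r - s)) * f r) * (-a * Real.exp (-a * (r - s))) =
      -a * duhamel a s c f r + f r := by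
    intro r
    have : Real.exp (a * (r - s)) * Real.exp (-a * (r - s)) = 1 := by
      rw [← Real.exp_add]; simp
    rw [duhamel]
    linear_combination (f r) * this
  simp only [e] at h2
  exact h2

lemma duhamel_sub (hsT : s ≤ T) {g : ℝ → ℝ} (hf : IntervalIntegrable f volume s T)
    (hg : IntervalIntegrable g volume s T) (a c c' : ℝ) (ht : t ∈ Icc s T) :
    duhamel a s c f t - duhamel a s c' g t = duhamel a s (c - c') (fun r => f r - g r) t := by
  have hm : ∀ f : ℝ → ℝ, IntervalIntegrable f volume s T →
      IntervalIntegrable (fun r => Real.exp (a * (r - s)) * f r) volume s t := fun f hf =>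
    (hf.continuousOn_mul (by fun_prop)).mono_set (by
      rw [uIcc_of_le ht.1, uIcc_of_le hsT]; exact Icc_subset_Icc_right ht.2)
  have e : ∀ r, Real.exp (a * (r - s)) * (f r - g r) =
      Real.exp (a * (r - s)) * f r - Real.exp (a * (r - s)) * g r := fun r => mul_sub _ _ _
  simp only [duhamel, e]
  rw [intervalIntegral.integral_sub (hm f hf) (hm g hg)]
  ring

lemma duhamel_congr {g : ℝ → ℝ} (hfg : ∀ᵐ r ∂(volume.restrict (Icc s T)), f r = g r) (a c : ℝ)
    (ht : t ∈ Icc s T) : duhamel a s c f t = duhamel a s c g t := by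
  have : ∫ r in s..t, Real.exp (a * (r - s)) * f r = ∫ r in s..t, Real.exp (a * (r - s)) * g r := by
    refine intervalIntegral.integral_congr_ae ?_
    rw [ae_restrict_iff' measurableSet_Icc] at hfg
    filter_upwards [hfg] with r hr hr'
    rw [uIoc_of_le ht.1] at hr'
    rw [hr ⟨hr'.1.le, hr'.2.trans ht.2⟩]
  rw [duhamel, duhamel, this]

/-- Shifting the damping by an exponential factor. -/
lemma exp_mul_duhamel (a μ s c : ℝ) (f : ℝ → ℝ) (t : ℝ) :
    Real.exp (μ * (t - s)) * duhamel (a + μ) s c f t =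
      duhamel a s c (fun r => Real.exp (μ * (r - s)) * f r) t := by
  have e1 : ∀ r, Real.exp ((a + μ) * (r - s)) * f r =
      Real.exp (a * (r - s)) * (Real.exp (μ * (r - s)) * f r) := fun r => by
    rw [add_mul, Real.exp_add]; ring
  have e2 : Real.exp (μ * (t - s)) * Real.exp (-(a + μ) * (t - s)) = Real.exp (-a * (t - s)) := by
    rw [← Real.exp_add]; ring_nf
  simp only [duhamel, e1]
  rw [← e2]
  ring

lemma IsPrimitive.sq (hsT : s ≤ T) (H : IsPrimitive y h s T) :
    y T ^ 2 = y s ^ 2 + ∫ r in s..T, 2 * (y r * h r) := by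
  rw [pow_two, pow_two, H.integral_mul hsT H]
  congr 1
  exact intervalIntegral.integral_congr fun r _ => by ring

/-- The energy estimate for `y' = -a y + f`. -/
lemma IsPrimitive.energy (hsT : s ≤ T) (ha : 0 < a)
    (H : IsPrimitive y (fun r => -a * y r + f r) s T)
    (hf2 : IntervalIntegrable (fun r => f r ^ 2) volume s T) :
    y T ^ 2 + a * ∫ r in s..T, y r ^ 2 ≤ y s ^ 2 + a⁻¹ * ∫ r in s..T, f r ^ 2 := by
  have hy : ContinuousOn y (uIcc s T) := by rw [uIcc_of_le hsT]; exact H.continuousOn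
  have hy2 : IntervalIntegrable (fun r => y r ^ 2) volume s T :=
    (hy.pow 2).intervalIntegrable
  have hle : ∫ r in s..T, 2 * (y r * (-a * y r + f r)) ≤
      ∫ r in s..T, (a⁻¹ * f r ^ 2 - a * y r ^ 2) := by
    refine intervalIntegral.integral_mono_on hsT ((H.integrable.continuousOn_mul hy).const_mul 2)
      ((hf2.const_mul _).sub (hy2.const_mul _)) fun r _ => ?_
    -- Young's inequality `2 y f ≤ a y² + a⁻¹ f²`, which uses half of the dissipation `2 a y²` and
    -- leaves the other half on the left-hand side.
    have : 0 ≤ a⁻¹ * (f r - a * y r) ^ 2 := by positivity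
    have e : a⁻¹ * (f r - a * y r) ^ 2 = a⁻¹ * f r ^ 2 - 2 * (y r * f r) + a * y r ^ 2 := by
      field_simp
      ring
    linarith
  rw [intervalIntegral.integral_sub (hf2.const_mul _) (hy2.const_mul _),
    intervalIntegral.integral_const_mul a⁻¹, intervalIntegral.integral_const_mul a] at hle
  have := H.sq hsT
  linarith

end Primitive

/-! ### Space-time functions through the coefficients of their time slices. -/

section Slices

variable {d : ℕ} {m : Measure ℝ} [IsFiniteMeasure m]

lemma ae_memLp_two_slice {F : ℝ → Torus d → ℝ}
    (hF : MemLp (fun p : ℝ × Torus d => F p.1 p.2) 2 (m.prod (dx d))) :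
    ∀ᵐ r ∂m, MemLp (F r) 2 (dx d) := by
  filter_upwards [hF.1.prodMk_left, hF.integrable_sq.prod_right_ae] with r h1 h2
  exact (memLp_two_iff_integrable_sq h1).2 h2

lemma ae_memLp_top_slice {m : Measure ℝ} {E : Type*} [NormedAddCommGroup E] {F : ℝ → Torus d → E}
    (hF : MemLp (fun p : ℝ × Torus d => F p.1 p.2) ∞ (m.prod (dx d))) :
    ∀ᵐ r ∂m, MemLp (F r) ∞ (dx d) := by
  have h0 : ∀ᵐ p ∂(m.prod (dx d)), ‖F p.1 p.2‖ₑ ≤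
      eLpNormEssSup (fun p : ℝ × Torus d => F p.1 p.2) (m.prod (dx d)) :=
    ae_le_eLpNormEssSup
  filter_upwards [hF.1.prodMk_left, Measure.ae_ae_of_ae_prod h0] with r h1 h2
  refine ⟨h1, lt_of_le_of_lt (b := eLpNormEssSup (fun p : ℝ × Torus d => F p.1 p.2)
    (m.prod (dx d))) ?_ ?_⟩
  · rw [eLpNorm_exponent_top]
    exact eLpNormEssSup_le_of_ae_enorm_bound h2
  · have := hF.2
    rwa [eLpNorm_exponent_top] at this

lemma ae_hasSum_coef_sq {F : ℝ → Torus d → ℝ}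
    (hF : MemLp (fun p : ℝ × Torus d => F p.1 p.2) 2 (m.prod (dx d))) :
    ∀ᵐ r ∂m, HasSum (fun k => coef (F r) k ^ 2) (∫ x, F r x ^ 2 ∂(dx d)) := by
  filter_upwards [ae_memLp_two_slice hF] with r hr
  simpa only [pow_two] using hasSum_coef_mul_coef hr hr

lemma memLp_coef {F : ℝ → Torus d → ℝ}
    (hF : MemLp (fun p : ℝ × Torus d => F p.1 p.2) 2 (m.prod (dx d))) (k : Fin d → ℤ) :
    MemLp (fun r => coef (F r) k) 2 m := by
  have hmeas : AEStronglyMeasurable (fun r => coef (F r) k) m :=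
    AEStronglyMeasurable.integral_prod_right' (f := fun p : ℝ × Torus d => F p.1 p.2 * cas k p.2)
      (hF.1.mul (smoothTorus_cas k).continuous.aestronglyMeasurable.comp_snd)
  rw [memLp_two_iff_integrable_sq hmeas]
  refine hF.integrable_sq.integral_prod_left.mono' (hmeas.pow 2) ?_
  filter_upwards [ae_hasSum_coef_sq hF] with r hr
  rw [Real.norm_of_nonneg (sq_nonneg _)]
  exact le_hasSum hr k fun _ _ => sq_nonneg _

/-- Parseval on the cylinder: Parseval on almost every slice, integrated in time. Finite partial
sums are bounded by Bessel's inequality, which justifies exchanging sum and integral. -/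
lemma hasSum_integral_coef_sq {F : ℝ → Torus d → ℝ}
    (hF : MemLp (fun p : ℝ × Torus d => F p.1 p.2) 2 (m.prod (dx d))) :
    HasSum (fun k => ∫ r, coef (F r) k ^ 2 ∂m)
      (∫ p, F p.1 p.2 ^ 2 ∂(m.prod (dx d))) := by
  have hi := fun k => (memLp_coef hF k).integrable_sq
  have hs : Summable fun k => ∫ r, coef (F r) k ^ 2 ∂m := by
    refine summable_of_sum_le (c := ∫ r, ∫ x, F r x ^ 2 ∂(dx d) ∂m)
      (fun k => integral_nonneg fun r => sq_nonneg _) fun S => ?_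
    rw [← integral_finsetSum _ fun k _ => hi k]
    refine integral_mono_ae (integrable_finsetSum _ fun k _ => hi k)
      hF.integrable_sq.integral_prod_left ?_
    filter_upwards [ae_hasSum_coef_sq hF] with r hr
    exact sum_le_hasSum S (fun _ _ => sq_nonneg _) hr
  have h1 := hasSum_integral_of_summable_integral_norm hi (by
    simpa only [norm_pow, Real.norm_eq_abs, sq_abs] using hs)
  convert! h1 using 1
  rw [integral_prod _ hF.integrable_sq]
  refine integral_congr_ae ?_
  filter_upwards [ae_hasSum_coef_sq hF] with r hr
  exact hr.tsum_eq.symm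

/-- Integration of a termwise product of two square-summable families of functions. -/
lemma hasSum_integral_mul {m : Measure ℝ} {ι : Type*} [Countable ι] {a b : ι → ℝ → ℝ} {c : ℝ → ℝ}
    (ha : ∀ k, MemLp (a k) 2 m) (hb : ∀ k, MemLp (b k) 2 m)
    (hsa : Summable fun k => ∫ r, a k r ^ 2 ∂m) (hsb : Summable fun k => ∫ r, b k r ^ 2 ∂m)
    (hc : ∀ᵐ r ∂m, HasSum (fun k => a k r * b k r) (c r)) :
    HasSum (fun k => ∫ r, a k r * b k r ∂m) (∫ r, c r ∂m) := by
  have hi : ∀ k, Integrable (fun r => a k r * b k r) m := fun k => (ha k).integrable_fun_mul (hb k)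
  have hs : Summable fun k => ∫ r, ‖a k r * b k r‖ ∂m := by
    refine Summable.of_nonneg_of_le (fun k => integral_nonneg fun r => norm_nonneg _)
      (fun k => ?_) (hsa.add hsb)
    rw [← integral_add (ha k).integrable_sq (hb k).integrable_sq]
    refine integral_mono (hi k).norm ((ha k).integrable_sq.add (hb k).integrable_sq) fun r => ?_
    simp only [Real.norm_eq_abs, abs_mul]
    nlinarith [sq_abs (a k r), sq_abs (b k r), sq_nonneg (|a k r| - |b k r|),
      sq_nonneg (a k r), sq_nonneg (b k r)]
  have h1 := hasSum_integral_of_summable_integral_norm hi hs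
  rwa [integral_congr_ae (g := c) (hc.mono fun r hr => hr.tsum_eq)] at h1

end Slices

/-! ### Energy inequality and uniqueness for weak solutions. -/

section Energy

variable {d : ℕ}

/-- Lebesgue measure on the space-time cylinder `[s,T] × 𝕋^d`. -/
noncomputable abbrev cyl (d : ℕ) (s T : ℝ) : Measure (ℝ × Torus d) :=
  (volume.restrict (Icc s T)).prod (dx d)

/-- `v` is a bounded divergence-free flow on `[s,T] × 𝕋^d`. -/
structure IsFlow (v : ℝ → Torus d → Vec d) (s T : ℝ) : Prop where
  memLp : MemLp (fun p : ℝ × Torus d => v p.1 p.2) ∞ (cyl d s T)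
  divFree : ∀ᵐ t ∂(volume.restrict (Icc s T)), WeakDivFree (v t)

lemma cyl_mono {s T a b : ℝ} (h : Icc a b ⊆ Icc s T) : cyl d a b ≤ cyl d s T :=
  Measure.prod_mono (Measure.restrict_mono h le_rfl) le_rfl

lemma IsFlow.mono {v : ℝ → Torus d → Vec d} {s T a b : ℝ} (hv : IsFlow v s T)
    (h : Icc a b ⊆ Icc s T) : IsFlow v a b :=
  ⟨hv.memLp.mono_measure (cyl_mono h), ae_restrict_of_ae_restrict_of_subset h hv.divFree⟩

lemma _root_.MeasureTheory.MemLp.component {X : Type*} [MeasurableSpace X] {μ : Measure X}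
    {f : X → Vec d} {p : ℝ≥0∞} (hf : MemLp f p μ) (i : Fin d) : MemLp (fun x => f x i) p μ :=
  (EuclideanSpace.proj (𝕜 := ℝ) i).comp_memLp' hf

lemma inner_eq_sum (a b : Vec d) : ⟪a, b⟫_ℝ = ∑ i, a i * b i := by
  simp [PiLp.inner_apply, mul_comm]

lemma _root_.MeasureTheory.MemLp.inner_vec {X : Type*} [MeasurableSpace X] {μ : Measure X}
    {v g : X → Vec d} (hv : MemLp v ∞ μ) (hg : MemLp g 2 μ) :
    MemLp (fun x => ⟪v x, g x⟫_ℝ) 2 μ := by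
  simp_rw [inner_eq_sum]
  exact memLp_finsetSum _ fun i _ => MemLp.mul' (p := ∞) (q := 2) (hg.component i) (hv.component i)

lemma _root_.Continuous.memLp_cyl {E : Type*} [NormedAddCommGroup E]
    [SecondCountableTopology E] {ψ : Torus d → E}
    (hψ : Continuous ψ) (s T : ℝ) (p : ℝ≥0∞) :
    MemLp (fun q : ℝ × Torus d => ψ q.2) p (cyl d s T) := by
  obtain ⟨C, hC⟩ := isCompact_univ.exists_bound_of_continuousOn hψ.continuousOn
  exact MemLp.of_bound (hψ.comp continuous_snd).aestronglyMeasurable C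
    (Eventually.of_forall fun x => hC x.2 (mem_univ _))

lemma SmoothTorus.continuous_grad {ψ : Torus d → ℝ} (hψ : SmoothTorus ψ) :
    Continuous (grad ψ) :=
  (PiLp.continuous_toLp 2 _).comp (continuous_pi fun i => (hψ.pderiv i).continuous)

lemma memLp_integrand {v g : ℝ → Torus d → Vec d} {s T : ℝ} (ν : ℝ)
    (hv : MemLp (fun p : ℝ × Torus d => v p.1 p.2) ∞ (cyl d s T))
    (hg : MemLp (fun p : ℝ × Torus d => g p.1 p.2) 2 (cyl d s T))
    {ψ : Torus d → ℝ} (hψ : SmoothTorus ψ) :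
    MemLp (fun p : ℝ × Torus d => - ν * ⟪g p.1 p.2, grad ψ p.2⟫_ℝ -
      ⟪v p.1 p.2, g p.1 p.2⟫_ℝ * ψ p.2) 2 (cyl d s T) := by
  have h1 := (hψ.continuous_grad.memLp_cyl s T ∞).inner_vec hg
  have h2 : MemLp (fun p : ℝ × Torus d => ⟪v p.1 p.2, g p.1 p.2⟫_ℝ * ψ p.2) 2 (cyl d s T) :=
    MemLp.mul' (p := 2) (q := ∞) (hψ.continuous.memLp_cyl s T ∞) (hv.inner_vec hg)
  simp_rw [real_inner_comm (grad ψ _)]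
  exact (h1.const_mul (-ν)).sub h2

lemma intervalIntegrable_of_Icc {h : ℝ → ℝ} {s T : ℝ} (hsT : s ≤ T)
    (hh : Integrable h (volume.restrict (Icc s T))) : IntervalIntegrable h volume s T := by
  rw [intervalIntegrable_iff_integrableOn_Icc_of_le hsT]
  exact hh

lemma intervalIntegral_eq_Icc (h : ℝ → ℝ) {s T : ℝ} (hsT : s ≤ T) :
    ∫ r in s..T, h r = ∫ r in Icc s T, h r := by
  rw [intervalIntegral.integral_of_le hsT, integral_Icc_eq_integral_Ioc]

/-- The weak formulation on `[a,t]` is the difference of those on `[s,t]` and `[s,a]`. Boundedness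
of the flow makes the integrand integrable, so the integrals may be subtracted. -/
lemma IsSolution.mono {v : ℝ → Torus d → Vec d} {ν s T a b : ℝ} {θ : ℝ → L20 d}
    (hθ : IsSolution v ν s T θ) (hv : IsFlow v s T) (hsa : s ≤ a) (hbT : b ≤ T) :
    IsSolution v ν a b θ := by
  obtain ⟨hc, g, hg, hgrad, hw⟩ := hθ
  have hsub : Icc a b ⊆ Icc s T := Icc_subset_Icc hsa hbT
  refine ⟨hc.mono hsub, g, hg.mono_measure (cyl_mono hsub),
    ae_restrict_of_ae_restrict_of_subset hsub hgrad, fun ψ hψ t ht => ?_⟩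
  have haT : a ∈ Icc s T := hsub (left_mem_Icc.2 (ht.1.trans ht.2))
  have htT : t ∈ Icc s T := hsub ht
  have h1 := hw ψ hψ t htT
  have h2 := hw ψ hψ a haT
  have hint : IntervalIntegrable (fun r => ∫ x, (- ν * ⟪g r x, grad ψ x⟫_ℝ -
      ⟪v r x, g r x⟫_ℝ * ψ x) ∂(dx d)) volume s T :=
    intervalIntegrable_of_Icc (htT.1.trans htT.2)
      ((memLp_integrand ν hv.memLp hg hψ).integrable (by norm_num)).integral_prod_left
  have hmono : ∀ t ∈ Icc s T, IntervalIntegrable (fun r => ∫ x, (- ν * ⟪g r x, grad ψ x⟫_ℝ -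
      ⟪v r x, g r x⟫_ℝ * ψ x) ∂(dx d)) volume s t := fun t ht => hint.mono_set (by
    rw [uIcc_of_le ht.1, uIcc_of_le (ht.1.trans ht.2)]; exact Icc_subset_Icc_right ht.2)
  rw [← intervalIntegral.integral_interval_sub_left (hmono t htT) (hmono a haT)]
  linarith

/-- The eigenvalue `4π²|k|²` of `-Δ`. -/
noncomputable def eig (k : Fin d → ℤ) : ℝ := ∑ i, (2 * Real.pi * k i) ^ 2

lemma eig_nonneg (k : Fin d → ℤ) : 0 ≤ eig k := Finset.sum_nonneg fun _ _ => sq_nonneg _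

lemma HasWeakGrad.integral_inner_grad_cas {w : Torus d → ℝ} {g : Torus d → Vec d}
    (hg : ∀ i, MemLp (fun x => g x i) 2 (dx d)) (hw : HasWeakGrad w g) (k : Fin d → ℤ) :
    ∫ x, ⟪g x, grad (cas k) x⟫_ℝ ∂(dx d) = eig k * coef w k := by
  rw [integral_inner_eq_sum hg fun i => ((smoothTorus_cas k).pderiv i).memLp 2, eig,
    Finset.sum_mul]
  refine Finset.sum_congr rfl fun i _ => ?_
  have h1 : ∫ x, g x i * grad (cas k) x i ∂(dx d) =
      2 * Real.pi * k i * coef (fun x => g x i) (-k) := by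
    rw [coef, ← integral_const_mul]
    refine integral_congr_ae (Eventually.of_forall fun x => ?_)
    simp only [grad, pderiv_cas]
    ring
  rw [h1, hw.coef_eq]
  simp
  ring

lemma ae_memLp_two_slice_component {m : Measure ℝ} [IsFiniteMeasure m] {g : ℝ → Torus d → Vec d}
    (hg : MemLp (fun p : ℝ × Torus d => g p.1 p.2) 2 (m.prod (dx d))) :
    ∀ᵐ r ∂m, ∀ i, MemLp (fun x => g r x i) 2 (dx d) :=
  ae_all_iff.2 fun i => ae_memLp_two_slice (F := fun r x => g r x i) (hg.component i)

lemma ae_integral_integrand_cas {v g : ℝ → Torus d → Vec d} {s T : ℝ} (ν : ℝ)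
    (hv : MemLp (fun p : ℝ × Torus d => v p.1 p.2) ∞ (cyl d s T))
    (hg : MemLp (fun p : ℝ × Torus d => g p.1 p.2) 2 (cyl d s T)) {w : ℝ → Torus d → ℝ}
    (hw : ∀ᵐ r ∂(volume.restrict (Icc s T)), HasWeakGrad (w r) (g r)) (k : Fin d → ℤ) :
    ∀ᵐ r ∂(volume.restrict (Icc s T)),
      ∫ x, (- ν * ⟪g r x, grad (cas k) x⟫_ℝ - ⟪v r x, g r x⟫_ℝ * cas k x) ∂(dx d) =
        -(ν * eig k) * coef (w r) k + -coef (fun x => ⟪v r x, g r x⟫_ℝ) k := by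
  filter_upwards [hw, ae_memLp_two_slice_component hg,
    ae_memLp_two_slice (F := fun r x => ⟪v r x, g r x⟫_ℝ) (hv.inner_vec hg)] with r h1 h2 h3
  have hi : Integrable (fun x => ⟪g r x, grad (cas k) x⟫_ℝ) (dx d) := by
    simp_rw [inner_eq_sum]
    exact integrable_finsetSum _ fun i _ =>
      (h2 i).integrable_fun_mul (((smoothTorus_cas k).pderiv i).memLp 2)
  rw [integral_sub (hi.const_mul _) (h3.integrable_fun_mul (memLp_cas k 2)), integral_const_mul,
    h1.integral_inner_grad_cas h2]
  simp only [coef]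
  ring

lemma memLp_coe (w : L20 d) : MemLp (w.1 : Torus d → ℝ) 2 (dx d) := Lp.memLp _

lemma continuousOn_coef {θ : ℝ → L20 d} {S : Set ℝ} (h : ContinuousOn θ S) (k : Fin d → ℤ) :
    ContinuousOn (fun r => coef (θ r).1 k) S := by
  simp_rw [← inner_hartley_eq_coef]
  exact (continuous_subtype_val.comp_continuousOn h).inner continuousOn_const

lemma hasSum_coef_sq (w : L20 d) : HasSum (fun k => coef w.1 k ^ 2) (‖w‖ ^ 2) := by
  have h := hasSum_coef_mul_coef (memLp_coe w) (memLp_coe w)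
  have e : ∫ x, w.1 x * w.1 x ∂(dx d) = ‖w‖ ^ 2 := by
    rw [← real_inner_self_eq_norm_sq, Submodule.coe_inner, L2.inner_def]
    rfl
  rw [e] at h
  simpa only [pow_two] using h

/-- The Hartley modes of a weak solution. -/
lemma IsSolution.modes {v : ℝ → Torus d → Vec d} {ν s T : ℝ} {θ : ℝ → L20 d} (hsT : s ≤ T)
    (hθ : IsSolution v ν s T θ) (hv : IsFlow v s T) :
    ∃ f : ℝ → Torus d → ℝ, MemLp (fun p : ℝ × Torus d => f p.1 p.2) 2 (cyl d s T) ∧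
      (∀ᵐ r ∂(volume.restrict (Icc s T)), ∫ x, f r x * (θ r).1 x ∂(dx d) = 0) ∧
      ∀ k, IsPrimitive (fun r => coef (θ r).1 k)
        (fun r => -(ν * eig k) * coef (θ r).1 k + -coef (f r) k) s T := by
  obtain ⟨hc, g, hg, hgrad, hw⟩ := hθ
  refine ⟨fun r x => ⟪v r x, g r x⟫_ℝ, hv.memLp.inner_vec hg, ?_, fun k => ⟨?_, fun t ht => ?_⟩⟩
  -- The forcing is the transport term `v · ∇θ`, which is orthogonal to `θ` since `v` is
  -- divergence-free.
  · filter_upwards [ae_memLp_top_slice hv.memLp, hv.divFree, hgrad,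
      ae_memLp_two_slice_component hg] with r h1 h2 h3 h4
    exact h2.integral_inner_mul_eq_zero (fun i => h1.component i) h4 (memLp_coe _) h3
  · refine IntervalIntegrable.add ?_ (intervalIntegrable_of_Icc hsT
      ((memLp_coef (hv.memLp.inner_vec hg) k).integrable (by norm_num))).neg
    refine (ContinuousOn.intervalIntegrable ?_).const_mul _
    rw [uIcc_of_le hsT]
    exact continuousOn_coef hc k
  · have h1 := hw _ (smoothTorus_cas k) t ht
    have h2 := ae_integral_integrand_cas ν hv.memLp hg hgrad k
    rw [ae_restrict_iff' measurableSet_Icc] at h2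
    have h3 := intervalIntegral.integral_congr_ae (a := s) (b := t) (μ := volume)
      (h2.mono fun r hr hr' => hr (by
        rw [uIoc_of_le ht.1] at hr'; exact ⟨hr'.1.le, hr'.2.trans ht.2⟩))
    rw [h3] at h1
    simp only [coef] at h1 ⊢
    linarith

/-- The energy inequality. -/
lemma IsSolution.norm_le {v : ℝ → Torus d → Vec d} {ν s T : ℝ} {θ : ℝ → L20 d} (hν : 0 ≤ ν)
    (hsT : s ≤ T) (hθ : IsSolution v ν s T θ) (hv : IsFlow v s T) : ‖θ T‖ ≤ ‖θ s‖ := by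
  obtain ⟨f, hf, hf0, hmode⟩ := hθ.modes hsT hv
  set m : Measure ℝ := volume.restrict (Icc s T)
  have hcont := fun k => continuousOn_coef hθ.1 k
  have hmem : ∀ k, MemLp (fun r => coef (θ r).1 k) 2 m := fun k => by
    rw [memLp_two_iff_integrable_sq ((hcont k).aestronglyMeasurable measurableSet_Icc)]
    exact ((hcont k).pow 2).integrableOn_Icc
  have hsum : Summable fun k => ∫ r, coef (θ r).1 k ^ 2 ∂m := by
    refine summable_of_sum_le (c := ∫ r, ‖θ r‖ ^ 2 ∂m)
      (fun k => integral_nonneg fun r => sq_nonneg _) fun S => ?_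
    rw [← integral_finsetSum _ fun k _ => (hmem k).integrable_sq]
    exact integral_mono (integrable_finsetSum _ fun k _ => (hmem k).integrable_sq)
      ((hθ.1.norm.pow 2).integrableOn_Icc)
      fun r => sum_le_hasSum S (fun _ _ => sq_nonneg _) (hasSum_coef_sq (θ r))
  -- The transport term moves energy between modes, but its contributions sum to zero.
  -- Square-summability of both families allows the sum to be taken after the time integral.
  have h0 : HasSum (fun k => ∫ r, coef (f r) k * coef (θ r).1 k ∂m) 0 := by
    have := hasSum_integral_mul (c := fun _ => 0) (fun k => memLp_coef hf k) hmem
      (hasSum_integral_coef_sq hf).summable hsum (by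
        filter_upwards [hf0, ae_memLp_two_slice hf] with r h1 h2
        rw [← h1]
        exact hasSum_coef_mul_coef h2 (memLp_coe _))
    simpa using this
  -- The energy identity of one mode with the nonnegative diffusion term discarded; summation over
  -- `k` then uses `h0`.
  have hle : ∀ k, coef (θ T).1 k ^ 2 ≤
      coef (θ s).1 k ^ 2 + (-2) * ∫ r, coef (f r) k * coef (θ r).1 k ∂m := by
    intro k
    have h1 := (hmode k).sq hsT
    rw [h1, intervalIntegral_eq_Icc _ hsT, ← integral_const_mul]
    refine add_le_add_right (integral_mono ?_ ?_ fun r => ?_) _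
    · have hy : ContinuousOn (fun r => coef (θ r).1 k) (uIcc s T) := by
        rw [uIcc_of_le hsT]; exact hcont k
      have := ((hmode k).integrable.continuousOn_mul hy).const_mul 2
      rwa [intervalIntegrable_iff_integrableOn_Icc_of_le hsT] at this
    · exact ((memLp_coef hf k).integrable_fun_mul (hmem k)).const_mul _
    · have : 0 ≤ ν * eig k * coef (θ r).1 k ^ 2 :=
        mul_nonneg (mul_nonneg hν (eig_nonneg k)) (sq_nonneg _)
      dsimp only
      nlinarith
  have h2 := hasSum_le hle (hasSum_coef_sq (θ T)) ((hasSum_coef_sq (θ s)).add (h0.mul_left (-2)))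
  rw [mul_zero, add_zero] at h2
  exact (sq_le_sq₀ (norm_nonneg _) (norm_nonneg _)).1 h2

lemma IsSolution.antitoneOn_norm {v : ℝ → Torus d → Vec d} {ν s T : ℝ} {θ : ℝ → L20 d}
    (hν : 0 ≤ ν) (hθ : IsSolution v ν s T θ) (hv : IsFlow v s T) :
    AntitoneOn (fun t => ‖θ t‖) (Icc s T) := fun _ ha _ hb hab =>
  (hθ.mono hv ha.1 hb.2).norm_le hν hab (hv.mono (Icc_subset_Icc ha.1 hb.2))

lemma HasWeakGrad.sub {f f' : Torus d → ℝ} {g g' : Torus d → Vec d}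
    (hf : MemLp f 2 (dx d)) (hf' : MemLp f' 2 (dx d)) (hg : ∀ i, MemLp (fun x => g x i) 2 (dx d))
    (hg' : ∀ i, MemLp (fun x => g' x i) 2 (dx d)) (h : HasWeakGrad f g) (h' : HasWeakGrad f' g') :
    HasWeakGrad (fun x => f x - f' x) (fun x => g x - g' x) := by
  refine hasWeakGrad_of_coef (hf.sub hf') (fun i => (hg i).sub (hg' i)) fun i k => ?_
  have := coef_sub (hg i) (hg' i) k
  simp only [PiLp.sub_apply]
  rw [this, coef_sub hf hf', h.coef_eq, h'.coef_eq]
  ring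

lemma HasWeakGrad.congr {f f' : Torus d → ℝ} {g : Torus d → Vec d} (h : HasWeakGrad f g)
    (hff' : f =ᵐ[dx d] f') : HasWeakGrad f' g := fun ψ hψ i => by
  rw [← h ψ hψ i]
  exact integral_congr_ae (hff'.mono fun x hx => by simp only [hx])

lemma coe_sub_ae (a b : L20 d) : ((a - b).1 : Torus d → ℝ) =ᵐ[dx d] fun x => a.1 x - b.1 x :=
  Lp.coeFn_sub a.1 b.1

lemma IsSolution.sub {v : ℝ → Torus d → Vec d} {ν s T : ℝ} {θ η : ℝ → L20 d}
    (hθ : IsSolution v ν s T θ) (hη : IsSolution v ν s T η) (hv : IsFlow v s T) :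
    IsSolution v ν s T (fun t => θ t - η t) := by
  obtain ⟨hc, g, hg, hgrad, hw⟩ := hθ
  obtain ⟨hc', g', hg', hgrad', hw'⟩ := hη
  refine ⟨hc.sub hc', fun r x => g r x - g' r x, hg.sub hg', ?_, fun ψ hψ t ht => ?_⟩
  · filter_upwards [hgrad, hgrad', ae_memLp_two_slice_component hg,
      ae_memLp_two_slice_component hg'] with r h1 h2 h3 h4
    exact (h1.sub (memLp_coe _) (memLp_coe _) h3 h4 h2).congr (coe_sub_ae _ _).symm
  · have hint : ∀ t, ∫ x, (θ t - η t).1 x * ψ x ∂(dx d) =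
        ∫ x, (θ t).1 x * ψ x ∂(dx d) - ∫ x, (η t).1 x * ψ x ∂(dx d) := fun t => by
      rw [← integral_sub ((memLp_coe _).integrable_fun_mul (hψ.memLp 2))
        ((memLp_coe _).integrable_fun_mul (hψ.memLp 2))]
      refine integral_congr_ae ?_
      filter_upwards [coe_sub_ae (θ t) (η t)] with x hx
      rw [hx, sub_mul]
    have hI := memLp_integrand ν hv.memLp hg hψ
    have hI' := memLp_integrand ν hv.memLp hg' hψ
    have hii : ∀ {h : ℝ → ℝ}, Integrable h (volume.restrict (Icc s T)) →
        IntervalIntegrable h volume s t := fun hh =>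
      intervalIntegrable_of_Icc ht.1 (hh.mono_measure
        (Measure.restrict_mono (Icc_subset_Icc_right ht.2) le_rfl))
    rw [hint, hint]
    have e1 := hw ψ hψ t ht
    have e2 := hw' ψ hψ t ht
    have e3 := intervalIntegral.integral_sub
      (hii (hI.integrable (by norm_num)).integral_prod_left)
      (hii (hI'.integrable (by norm_num)).integral_prod_left)
    -- Splitting the spatial integral requires integrable slices, hence only almost every `r`.
    have e4 : ∀ᵐ r ∂(volume.restrict (Icc s T)),
        ∫ x, (- ν * ⟪g r x - g' r x, grad ψ x⟫_ℝ - ⟪v r x, g r x - g' r x⟫_ℝ * ψ x) ∂(dx d) =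
        ∫ x, (- ν * ⟪g r x, grad ψ x⟫_ℝ - ⟪v r x, g r x⟫_ℝ * ψ x) ∂(dx d) -
        ∫ x, (- ν * ⟪g' r x, grad ψ x⟫_ℝ - ⟪v r x, g' r x⟫_ℝ * ψ x) ∂(dx d) := by
      filter_upwards [(hI.integrable (by norm_num)).prod_right_ae,
        (hI'.integrable (by norm_num)).prod_right_ae] with r h1 h2
      rw [← integral_sub h1 h2]
      refine integral_congr_ae (Eventually.of_forall fun x => ?_)
      simp only [inner_sub_left, inner_sub_right]
      ring
    rw [ae_restrict_iff' measurableSet_Icc] at e4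
    have e5 := intervalIntegral.integral_congr_ae (a := s) (b := t) (μ := volume)
      (e4.mono fun r hr hr' => hr (by
        rw [uIoc_of_le ht.1] at hr'; exact ⟨hr'.1.le, hr'.2.trans ht.2⟩))
    rw [e5, e3]
    linarith

/-- Uniqueness of weak solutions. -/
lemma IsSolution.eq_of_eq {v : ℝ → Torus d → Vec d} {ν s T : ℝ} {θ η : ℝ → L20 d} (hν : 0 ≤ ν)
    (hθ : IsSolution v ν s T θ) (hη : IsSolution v ν s T η) (hv : IsFlow v s T)
    (h0 : θ s = η s) {t : ℝ} (ht : t ∈ Icc s T) : θ t = η t := by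
  have h := (hθ.sub hη hv).antitoneOn_norm hν hv (left_mem_Icc.2 (ht.1.trans ht.2)) ht ht.1
  simp only [h0, sub_self, norm_zero] at h
  exact sub_eq_zero.1 (norm_le_zero_iff.1 h)

end Energy

/-! ### Building functions and weak solutions from their modes. -/

section Synthesis

variable {d : ℕ} {m : Measure ℝ}

lemma exists_coef_eq {c : (Fin d → ℤ) → ℝ} (hc : Summable fun k => c k ^ 2) :
    ∃ w : Lp ℝ 2 (dx d), ∀ k, coef w k = c k := by
  have hmem : Memℓp c 2 := by
    refine memℓp_gen ?_
    simpa using hc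
  refine ⟨(hartley d).repr.symm ⟨c, hmem⟩, fun k => ?_⟩
  rw [← inner_hartley_eq_coef, real_inner_comm, ← HilbertBasis.repr_apply_apply,
    LinearIsometryEquiv.apply_symm_apply]

lemma memLp_tensor {w : ℝ → ℝ} (hw : MemLp w 2 m) (k : Fin d → ℤ) :
    MemLp (fun p : ℝ × Torus d => w p.1 * cas k p.2) 2 (m.prod (dx d)) := by
  have hmeas : AEStronglyMeasurable (fun p : ℝ × Torus d => w p.1 * cas k p.2)
      (m.prod (dx d)) :=
    hw.1.comp_fst.mul (smoothTorus_cas k).continuous.aestronglyMeasurable.comp_snd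
  rw [memLp_two_iff_integrable_sq hmeas]
  simp_rw [mul_pow]
  exact hw.integrable_sq.mul_prod (memLp_cas k 2).integrable_sq

/-- The element `w ⊗ cas_k` of `L²` of the cylinder. -/
noncomputable def tensor {w : ℝ → ℝ} (hw : MemLp w 2 m) (k : Fin d → ℤ) :
    Lp ℝ 2 (m.prod (dx d)) := (memLp_tensor hw k).toLp _

lemma inner_tensor [SFinite m] (G : Lp ℝ 2 (m.prod (dx d))) {w : ℝ → ℝ} (hw : MemLp w 2 m)
    (k : Fin d → ℤ) :
    ⟪G, tensor hw k⟫_ℝ = ∫ r, coef (fun x => G (r, x)) k * w r ∂m := by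
  have h1 : ⟪G, tensor hw k⟫_ℝ = ∫ p, G p * (w p.1 * cas k p.2) ∂(m.prod (dx d)) := by
    rw [L2.inner_def]
    refine integral_congr_ae ?_
    filter_upwards [(memLp_tensor hw k).coeFn_toLp] with p hp
    rw [tensor, hp]
    simp [mul_comm]
  rw [h1, integral_prod _ ((Lp.memLp G).integrable_fun_mul (memLp_tensor hw k))]
  refine integral_congr_ae (Eventually.of_forall fun r => ?_)
  simp only [coef, ← integral_mul_const]
  exact integral_congr_ae (Eventually.of_forall fun x => by ring)

lemma inner_tensor_tensor [SFinite m] {w w' : ℝ → ℝ} (hw : MemLp w 2 m) (hw' : MemLp w' 2 m)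
    (k l : Fin d → ℤ) :
    ⟪tensor hw k, tensor hw' l⟫_ℝ = if k = l then ∫ r, w r * w' r ∂m else 0 := by
  have h1 : ⟪tensor hw k, tensor hw' l⟫_ℝ =
      ∫ p : ℝ × Torus d, (w p.1 * w' p.1) * (cas k p.2 * cas l p.2) ∂(m.prod (dx d)) := by
    rw [L2.inner_def]
    refine integral_congr_ae ?_
    filter_upwards [(memLp_tensor hw k).coeFn_toLp, (memLp_tensor hw' l).coeFn_toLp] with p hp hp'
    rw [tensor, tensor, hp, hp']
    simp
    ring
  rw [h1, integral_prod_mul (fun r => w r * w' r) fun x => cas k x * cas l x, integral_cas_mul_cas]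
  split_ifs <;> simp

lemma orthogonalFamily_span {E ι : Type*} [NormedAddCommGroup E] [InnerProductSpace ℝ E]
    {h : ι → E} (ho : Pairwise fun k l => ⟪h k, h l⟫_ℝ = 0) :
    OrthogonalFamily ℝ (fun k => (ℝ ∙ h k : Submodule ℝ E))
      fun k => (ℝ ∙ h k : Submodule ℝ E).subtypeₗᵢ := by
  rintro k l hkl ⟨x, hx⟩ ⟨y, hy⟩
  obtain ⟨a, rfl⟩ := Submodule.mem_span_singleton.1 hx
  obtain ⟨b, rfl⟩ := Submodule.mem_span_singleton.1 hy
  simp [inner_smul_left, inner_smul_right, ho hkl]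

lemma summable_of_orthogonal {E ι : Type*} [NormedAddCommGroup E] [InnerProductSpace ℝ E]
    [CompleteSpace E] {h : ι → E} (ho : Pairwise fun k l => ⟪h k, h l⟫_ℝ = 0)
    (hs : Summable fun k => ‖h k‖ ^ 2) : Summable h :=
  ((orthogonalFamily_span ho).summable_iff_norm_sq_summable
    fun k => ⟨h k, Submodule.mem_span_singleton_self _⟩).2 hs

/-- A square-summable family of modes is the family of coefficients of a function in `L²` of the
cylinder. -/
lemma exists_slice_coef_eq [IsFiniteMeasure m] {z : (Fin d → ℤ) → ℝ → ℝ} (hz : ∀ k, MemLp (z k) 2 m)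
    (hs : Summable fun k => ∫ r, z k r ^ 2 ∂m) :
    ∃ G : ℝ → Torus d → ℝ, MemLp (fun p : ℝ × Torus d => G p.1 p.2) 2 (m.prod (dx d)) ∧
      ∀ k, ∀ᵐ r ∂m, coef (G r) k = z k r := by
  -- The tensors with distinct `k` are orthogonal in `L²` of the cylinder, so summability of the
  -- squared norms gives convergence of the series.
  have hsum : Summable fun k => tensor (hz k) k := by
    refine summable_of_orthogonal (fun k l hkl => ?_) ?_
    · change ⟪tensor (hz k) k, tensor (hz l) l⟫_ℝ = 0
      rw [inner_tensor_tensor, if_neg hkl]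
    · refine hs.congr fun k => ?_
      rw [← real_inner_self_eq_norm_sq, inner_tensor_tensor, if_pos rfl]
      simp only [pow_two]
  set G := ∑' k, tensor (hz k) k with hG
  have hGm : MemLp (fun p : ℝ × Torus d => (fun r x => G (r, x)) p.1 p.2) 2 (m.prod (dx d)) :=
    Lp.memLp G
  refine ⟨fun r x => G (r, x), hGm, fun l => ?_⟩
  have hGl : MemLp (fun r => coef (fun x => G (r, x)) l) 2 m :=
    memLp_coef (F := fun r x => G (r, x)) hGm l
  -- Pairing `G` with the tensor of this discrepancy, computed once from the slices and once from
  -- the series, shows that the discrepancy has zero `L²` norm.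
  have hw : MemLp (fun r => coef (fun x => G (r, x)) l - z l r) 2 m := hGl.sub (hz l)
  have h1 : ⟪G, tensor hw l⟫_ℝ = ∫ r, z l r * (coef (fun x => G (r, x)) l - z l r) ∂m := by
    have h2 : HasSum (fun k => ⟪tensor (hz k) k, tensor hw l⟫_ℝ) ⟪G, tensor hw l⟫_ℝ := by
      simp only [real_inner_comm (tensor hw l)]
      exact hsum.hasSum.mapL (innerSL ℝ (tensor hw l))
    have h3 := hasSum_single (f := fun k => ⟪tensor (hz k) k, tensor hw l⟫_ℝ) l fun k hk => by
      rw [inner_tensor_tensor, if_neg hk]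
    rw [h2.unique h3, inner_tensor_tensor, if_pos rfl]
  rw [inner_tensor] at h1
  have h4 : ∫ r, (coef (fun x => G (r, x)) l - z l r) ^ 2 ∂m = 0 := by
    have e : ∀ r, (coef (fun x => G (r, x)) l - z l r) ^ 2 =
        coef (fun x => G (r, x)) l * (coef (fun x => G (r, x)) l - z l r) -
          z l r * (coef (fun x => G (r, x)) l - z l r) := fun r => by ring
    simp_rw [e]
    rw [integral_sub (hGl.integrable_fun_mul hw) ((hz l).integrable_fun_mul hw), h1, sub_self]
  rw [integral_eq_zero_iff_of_nonneg (fun r => sq_nonneg _) hw.integrable_sq] at h4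
  filter_upwards [h4] with r hr
  exact sub_eq_zero.1 (pow_eq_zero_iff (two_ne_zero)|>.1 hr)

lemma hasSum_integral_coef_mul [IsFiniteMeasure m] {F : ℝ → Torus d → ℝ} {φ : Torus d → ℝ}
    (hF : MemLp (fun p : ℝ × Torus d => F p.1 p.2) 2 (m.prod (dx d))) (hφ : MemLp φ 2 (dx d)) :
    HasSum (fun k => (∫ r, coef (F r) k ∂m) * coef φ k) (∫ r, ∫ x, F r x * φ x ∂(dx d) ∂m) := by
  have h := hasSum_integral_mul (b := fun k _ => coef φ k) (memLp_coef hF)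
    (fun k => memLp_const _) (hasSum_integral_coef_sq hF).summable
    (by
      simp only [integral_const, smul_eq_mul]
      refine Summable.mul_left _ ?_
      simpa only [pow_two] using (hasSum_coef_mul_coef hφ hφ).summable)
    ((ae_memLp_two_slice hF).mono fun r hr => hasSum_coef_mul_coef hr hφ)
  simpa only [integral_mul_const] using h

/-- Modewise continuity suffices under a summable bound uniform in time: dominated convergence for
the sum of the squared differences, each at most `4 * b k`. -/
lemma continuousOn_of_coef {θ : ℝ → L20 d} {S : Set ℝ} {b : (Fin d → ℤ) → ℝ} (hb : Summable b)
    (hc : ∀ k, ContinuousOn (fun r => coef (θ r).1 k) S)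
    (hle : ∀ t ∈ S, ∀ k, coef (θ t).1 k ^ 2 ≤ b k) : ContinuousOn θ S := by
  intro t ht
  have hcoef : ∀ r k, coef (θ r - θ t).1 k = coef (θ r).1 k - coef (θ t).1 k := fun r k => by
    rw [coef_congr (coe_sub_ae _ _), coef_sub (memLp_coe _) (memLp_coe _)]
  have hn : ∀ r, ‖θ r - θ t‖ ^ 2 = ∑' k, (coef (θ r).1 k - coef (θ t).1 k) ^ 2 := fun r => by
    rw [← (hasSum_coef_sq (θ r - θ t)).tsum_eq]
    simp_rw [hcoef]
  have hlim : Tendsto (fun r => ∑' k, (coef (θ r).1 k - coef (θ t).1 k) ^ 2) (𝓝[S] t)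
      (𝓝 (∑' _ : Fin d → ℤ, (0 : ℝ))) := by
    refine tendsto_tsum_of_dominated_convergence (bound := fun k => 4 * b k) (hb.mul_left 4)
      (fun k => ?_) ?_
    · have h0 : Tendsto (fun r => coef (θ r).1 k) (𝓝[S] t) (𝓝 (coef (θ t).1 k)) := hc k t ht
      have := (h0.sub_const (coef (θ t).1 k)).pow 2
      rw [sub_self, zero_pow two_ne_zero] at this
      exact this
    · filter_upwards [self_mem_nhdsWithin] with r hr k
      rw [Real.norm_of_nonneg (sq_nonneg _)]
      nlinarith [hle r hr k, hle t ht k, sq_nonneg (coef (θ r).1 k + coef (θ t).1 k)]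
  simp_rw [← hn, tsum_zero] at hlim
  rw [ContinuousWithinAt, tendsto_iff_norm_sub_tendsto_zero]
  have := hlim.sqrt
  simpa [Real.sqrt_sq (norm_nonneg _)] using this

/-- A function whose modes solve the equation is a weak solution. -/
lemma isSolution_of_modes {v g : ℝ → Torus d → Vec d} {ν s T : ℝ} {θ : ℝ → L20 d}
    (hv : MemLp (fun p : ℝ × Torus d => v p.1 p.2) ∞ (cyl d s T))
    (hg : MemLp (fun p : ℝ × Torus d => g p.1 p.2) 2 (cyl d s T)) (hθ : ContinuousOn θ (Icc s T))
    (hgθ : ∀ i k, ∀ᵐ r ∂(volume.restrict (Icc s T)),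
      coef (fun x => g r x i) k = -(2 * Real.pi * k i) * coef (θ r).1 (-k))
    (hmode : ∀ k, IsPrimitive (fun r => coef (θ r).1 k)
      (fun r => -(ν * eig k) * coef (θ r).1 k + -coef (fun x => ⟪v r x, g r x⟫_ℝ) k) s T) :
    IsSolution v ν s T θ := by
  refine ⟨hθ, g, hg, ?_, fun ψ hψ t ht => ?_⟩
  · filter_upwards [ae_memLp_two_slice_component hg,
      ae_all_iff.2 fun i => ae_all_iff.2 fun k => hgθ i k] with r h1 h2
    exact hasWeakGrad_of_coef (memLp_coe _) h1 h2
  have hsub : Icc s t ⊆ Icc s T := Icc_subset_Icc_right ht.2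
  have hv' := hv.mono_measure (cyl_mono hsub)
  have hg' := hg.mono_measure (cyl_mono hsub)
  have hvg := hv'.inner_vec hg'
  have hcoefint : ∀ k, Integrable (fun r => coef (θ r).1 k)
      (volume.restrict (Icc s t)) := fun k =>
    ((continuousOn_coef hθ k).mono hsub).integrableOn_Icc
  have hA : ∀ i k, ∫ r, coef (fun x => g r x i) k ∂(volume.restrict (Icc s t)) =
      -(2 * Real.pi * k i) * ∫ r, coef (θ r).1 (-k) ∂(volume.restrict (Icc s t)) := fun i k => by
    rw [← integral_const_mul]
    exact integral_congr_ae (ae_restrict_of_ae_restrict_of_subset hsub (hgθ i k))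
  have h1 := fun i => hasSum_integral_coef_mul (F := fun r x => g r x i) (hg'.component i)
    ((hψ.pderiv i).memLp 2)
  have h2 := hasSum_integral_coef_mul (F := fun r x => ⟪v r x, g r x⟫_ℝ) hvg (hψ.memLp 2)
  have h1' := (hasSum_sum fun i (_ : i ∈ Finset.univ) =>
    (Equiv.neg (Fin d → ℤ)).hasSum_iff.2 (h1 i)).mul_left (-ν)
  have hR := h1'.sub h2
  have hL := (hasSum_coef_mul_coef (memLp_coe (θ t)) (hψ.memLp 2)).sub
    (hasSum_coef_mul_coef (memLp_coe (θ s)) (hψ.memLp 2))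
  -- Both sides of the weak formulation are now series in the coefficients of `ψ`, so the mode
  -- equations match them term by term. The diffusion series was reindexed by `k ↦ -k` to undo the
  -- flip caused by each derivative.
  have hLR := hL.unique (hR.congr_fun fun k => ?_)
  · rw [hLR, intervalIntegral_eq_Icc _ ht.1]
    have hgi : ∀ i, Integrable (fun p : ℝ × Torus d => g p.1 p.2 i * pderiv i ψ p.2)
        (cyl d s t) := fun i =>
      (hg'.component i).integrable_fun_mul ((hψ.pderiv i).continuous.memLp_cyl s t 2)
    have hvi : Integrable (fun p : ℝ × Torus d => ⟪v p.1 p.2, g p.1 p.2⟫_ℝ * ψ p.2)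
        (cyl d s t) := hvg.integrable_fun_mul (hψ.continuous.memLp_cyl s t 2)
    have e : ∀ᵐ r ∂(volume.restrict (Icc s t)), ∫ x, (- ν * ⟪g r x, grad ψ x⟫_ℝ - ⟪v r x, g r x⟫_ℝ * ψ x) ∂(dx d) =
        -ν * ∑ i, ∫ x, g r x i * pderiv i ψ x ∂(dx d) - ∫ x, ⟪v r x, g r x⟫_ℝ * ψ x ∂(dx d) := by
      filter_upwards [ae_all_iff.2 fun i => (hgi i).prod_right_ae, hvi.prod_right_ae] with r h3 h4
      rw [← integral_finsetSum _ fun i _ => h3 i, ← integral_const_mul, ← integral_sub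
        ((integrable_finsetSum _ fun i _ => h3 i).const_mul _) h4]
      refine integral_congr_ae (Eventually.of_forall fun x => ?_)
      simp only [inner_eq_sum, grad]
    rw [integral_congr_ae e, integral_sub ((integrable_finsetSum _ fun i _ =>
      (hgi i).integral_prod_left).const_mul _) hvi.integral_prod_left, integral_const_mul,
      integral_finsetSum _ fun i _ => (hgi i).integral_prod_left]
  · have hm := (hmode k).eq t ht
    have hvk : Integrable (fun r => coef (fun x => ⟪v r x, g r x⟫_ℝ) k)
      (volume.restrict (Icc s t)) :=
      (memLp_coef (F := fun r x => ⟪v r x, g r x⟫_ℝ) hvg k).integrable (by norm_num)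
    rw [intervalIntegral_eq_Icc _ ht.1, integral_add ((hcoefint k).const_mul _) hvk.fun_neg,
      integral_const_mul, integral_neg] at hm
    simp only [Function.comp, Equiv.neg_apply, hA, hψ.coef_pderiv, neg_neg]
    have e : ∑ i, -(2 * Real.pi * ((-k) i : ℤ)) * (∫ r, coef (θ r).1 k ∂(volume.restrict (Icc s t))) *
        (-(2 * Real.pi * ((-k) i : ℤ)) * coef ψ k) =
        eig k * (∫ r, coef (θ r).1 k ∂(volume.restrict (Icc s t))) * coef ψ k := by
      rw [eig, Finset.sum_mul, Finset.sum_mul]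
      refine Finset.sum_congr rfl fun i _ => ?_
      push_cast [Pi.neg_apply]
      ring
    rw [e]
    linear_combination coef ψ k * hm

end Synthesis

/-! ### The damped heat equation and the contraction for the transport term. -/

section Existence

variable {d : ℕ}

lemma norm_sq_eq_integral {X : Type*} [MeasurableSpace X] {μ : Measure X} (A : Lp ℝ 2 μ) :
    ‖A‖ ^ 2 = ∫ x, A x ^ 2 ∂μ := by
  rw [← real_inner_self_eq_norm_sq, L2.inner_def]
  refine integral_congr_ae (Eventually.of_forall fun x => ?_)
  simp [pow_two]

lemma norm_toLp_sub_sq {X : Type*} [MeasurableSpace X] {μ : Measure X} {f g : X → ℝ}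
    (hf : MemLp f 2 μ) (hg : MemLp g 2 μ) :
    ‖hf.toLp f - hg.toLp g‖ ^ 2 = ∫ x, (f x - g x) ^ 2 ∂μ := by
  rw [← MemLp.toLp_sub hf hg, norm_sq_eq_integral]
  refine integral_congr_ae ?_
  filter_upwards [(hf.sub hg).coeFn_toLp] with x hx
  rw [hx, Pi.sub_apply]

lemma exists_ae_norm_le {X E : Type*} [MeasurableSpace X] [NormedAddCommGroup E] {μ : Measure X}
    {v : X → E} (hv : MemLp v ∞ μ) : ∃ M : ℝ, 0 ≤ M ∧ ∀ᵐ x ∂μ, ‖v x‖ ≤ M := by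
  have hfin : eLpNormEssSup v μ ≠ (∞ : ℝ≥0∞) := by
    have := hv.2.ne
    rwa [eLpNorm_exponent_top] at this
  refine ⟨(eLpNormEssSup v μ).toReal, ENNReal.toReal_nonneg, ?_⟩
  filter_upwards [ae_le_eLpNormEssSup (f := v) (μ := μ)] with x hx
  rw [← toReal_enorm]
  exact ENNReal.toReal_mono hfin hx

variable {s T : ℝ}

lemma intervalIntegrable_of_memLp {f : ℝ → ℝ} (hsT : s ≤ T)
    (hf : MemLp f 2 (volume.restrict (Icc s T))) : IntervalIntegrable f volume s T :=
  intervalIntegrable_of_Icc hsT (hf.integrable (by norm_num))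

lemma continuousOn_duhamel {f : ℝ → ℝ} (hsT : s ≤ T)
    (hf : MemLp f 2 (volume.restrict (Icc s T))) (a c : ℝ) :
    ContinuousOn (duhamel a s c f) (Icc s T) :=
  (isPrimitive_duhamel hsT a c (intervalIntegrable_of_memLp hsT hf)).continuousOn

lemma memLp_duhamel {f : ℝ → ℝ} (hsT : s ≤ T)
    (hf : MemLp f 2 (volume.restrict (Icc s T))) (a c : ℝ) :
    MemLp (duhamel a s c f) 2 (volume.restrict (Icc s T)) := by
  have hc := continuousOn_duhamel hsT hf a c
  rw [memLp_two_iff_integrable_sq (hc.aestronglyMeasurable measurableSet_Icc)]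
  exact (hc.pow 2).integrableOn_Icc

/-- The forcing is integrated over all of `[s,T]` so that the bound is uniform in `t`. The two terms
on the left give a pointwise bound, for continuity in time, and an `L²` bound, for the gradient. -/
lemma duhamel_energy {f : ℝ → ℝ} (hf : MemLp f 2 (volume.restrict (Icc s T))) {a : ℝ}
    (ha : 0 < a) (c : ℝ) {t : ℝ} (ht : t ∈ Icc s T) :
    duhamel a s c f t ^ 2 + a * ∫ r in Icc s t, duhamel a s c f r ^ 2 ≤
      c ^ 2 + a⁻¹ * ∫ r in Icc s T, f r ^ 2 := by
  have hsT := ht.1.trans ht.2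
  have hp := (isPrimitive_duhamel hsT a c (intervalIntegrable_of_memLp hsT hf)).mono ht
  have hsub : Icc s t ⊆ Icc s T := Icc_subset_Icc_right ht.2
  have hf2 : IntegrableOn (fun r => f r ^ 2) (Icc s T) := hf.integrable_sq
  have h := hp.energy ht.1 ha (intervalIntegrable_of_Icc ht.1 (hf2.mono_set hsub))
  rw [duhamel_self, intervalIntegral_eq_Icc _ ht.1, intervalIntegral_eq_Icc _ ht.1] at h
  refine h.trans (add_le_add_right (mul_le_mul_of_nonneg_left ?_ (inv_pos.2 ha).le) _)
  exact setIntegral_mono_set hf2 (Eventually.of_forall fun r => sq_nonneg _)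
    (Eventually.of_forall hsub)

lemma duhamel_sq_le {f : ℝ → ℝ} (hf : MemLp f 2 (volume.restrict (Icc s T))) {a : ℝ}
    (ha : 0 < a) (c : ℝ) {t : ℝ} (ht : t ∈ Icc s T) :
    duhamel a s c f t ^ 2 ≤ c ^ 2 + a⁻¹ * ∫ r in Icc s T, f r ^ 2 := by
  have h1 := duhamel_energy hf ha c ht
  have h2 : 0 ≤ a * ∫ r in Icc s t, duhamel a s c f r ^ 2 :=
    mul_nonneg ha.le (integral_nonneg fun r => sq_nonneg _)
  linarith

lemma integral_duhamel_sq_le {f : ℝ → ℝ} (hsT : s ≤ T)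
    (hf : MemLp f 2 (volume.restrict (Icc s T))) {a : ℝ} (ha : 0 < a) (c : ℝ) :
    a * ∫ r in Icc s T, duhamel a s c f r ^ 2 ≤ c ^ 2 + a⁻¹ * ∫ r in Icc s T, f r ^ 2 := by
  have h1 := duhamel_energy hf ha c (right_mem_Icc.2 hsT)
  have h2 := sq_nonneg (duhamel a s c f T)
  linarith

lemma sq_le_eig (k : Fin d → ℤ) (i : Fin d) : (2 * Real.pi * k i) ^ 2 ≤ eig k :=
  Finset.single_le_sum (f := fun i => (2 * Real.pi * (k i : ℝ)) ^ 2)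
    (fun _ _ => sq_nonneg _) (Finset.mem_univ i)

lemma eig_neg (k : Fin d → ℤ) : eig (-k) = eig k := by simp [eig]

/-- The gradient of the solution of the damped heat equation with source `F`. -/
lemma exists_heat_grad (hsT : s ≤ T) {ν μ : ℝ} (hν : 0 < ν) (hμ : 0 < μ)
    {c : (Fin d → ℤ) → ℝ} (hc : Summable fun k => c k ^ 2) {F : ℝ → Torus d → ℝ}
    (hF : MemLp (fun p : ℝ × Torus d => F p.1 p.2) 2 (cyl d s T)) :
    ∃ G : ℝ → Torus d → Vec d, MemLp (fun p : ℝ × Torus d => G p.1 p.2) 2 (cyl d s T) ∧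
      ∀ i k, ∀ᵐ r ∂(volume.restrict (Icc s T)), coef (fun x => G r x i) k =
        -(2 * Real.pi * k i) *
          duhamel (ν * eig (-k) + μ) s (c (-k)) (fun r => coef (F r) (-k)) r := by
  have hz : ∀ (i : Fin d) (k : Fin d → ℤ), MemLp (fun r => -(2 * Real.pi * k i) *
      duhamel (ν * eig (-k) + μ) s (c (-k)) (fun r => coef (F r) (-k)) r) 2
      (volume.restrict (Icc s T)) := fun i k =>
    (memLp_duhamel hsT (memLp_coef hF _) _ _).const_mul _
  have hs : ∀ i : Fin d, Summable fun k : Fin d → ℤ => ∫ r in Icc s T, (-(2 * Real.pi * k i) *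
      duhamel (ν * eig (-k) + μ) s (c (-k)) (fun r => coef (F r) (-k)) r) ^ 2 := by
    intro i
    have hb : Summable fun k => ν⁻¹ * (c k ^ 2 + μ⁻¹ * ∫ r in Icc s T, coef (F r) k ^ 2) :=
      (hc.add ((hasSum_integral_coef_sq hF).summable.mul_left _)).mul_left _
    rw [← (Equiv.neg (Fin d → ℤ)).summable_iff] at hb
    refine Summable.of_nonneg_of_le (fun k => integral_nonneg fun r => sq_nonneg _)
      (fun k => ?_) hb
    simp only [mul_pow, integral_const_mul, Function.comp, Equiv.neg_apply, neg_sq]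
    set Y := ∫ r in Icc s T,
      duhamel (ν * eig (-k) + μ) s (c (-k)) (fun r => coef (F r) (-k)) r ^ 2 with hY
    set Z := ∫ r in Icc s T, coef (F r) (-k) ^ 2 with hZ
    have hY0 : 0 ≤ Y := integral_nonneg fun r => sq_nonneg _
    have hZ0 : 0 ≤ Z := integral_nonneg fun r => sq_nonneg _
    have he := eig_nonneg (-k)
    have ha : 0 < ν * eig (-k) + μ := by positivity
    have h1 := integral_duhamel_sq_le hsT (memLp_coef hF (-k)) ha (c (-k))
    have h2 : (ν * eig (-k) + μ)⁻¹ ≤ μ⁻¹ :=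
      inv_anti₀ hμ (le_add_of_nonneg_left (mul_nonneg hν.le he))
    have h3 := mul_le_mul_of_nonneg_right h2 hZ0
    have h4 := mul_le_mul_of_nonneg_right (sq_le_eig k i) hY0
    rw [← eig_neg] at h4
    -- Of the dissipation rate `ν * eig (-k) + μ`, only the part that controls the gradient is kept.
    have h5 : ν * (eig (-k) * Y) ≤ c (-k) ^ 2 + μ⁻¹ * Z := by
      nlinarith [mul_nonneg hμ.le hY0]
    have h6 : eig (-k) * Y ≤ ν⁻¹ * (c (-k) ^ 2 + μ⁻¹ * Z) := by
      rw [le_inv_mul_iff₀ hν]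
      exact h5
    have h7 : (2 * Real.pi * (k i : ℝ)) ^ 2 * Y ≤ ν⁻¹ * (c (-k) ^ 2 + μ⁻¹ * Z) := h4.trans h6
    simpa only [mul_pow] using h7
  choose G hG hGc using fun i => exists_slice_coef_eq (hz i) (hs i)
  refine ⟨fun r x => WithLp.toLp 2 fun i => G i r x, MemLp.of_eval_piLp fun i => hG i, ?_⟩
  exact fun i k => hGc i k

/-- With `e = eig k`, the difference of the modes is driven by the difference of the sources with
damping rate `ν e + μ`, so its gradient energy is at most `e / (ν e + μ)²` times that of the
sources. Since `4 ν μ e ≤ (ν e + μ)²`, this factor is at most `1 / (4 ν μ)` for every mode: large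
`μ` makes it small. -/
lemma heat_grad_contraction (hsT : s ≤ T) {ν μ : ℝ} (hν : 0 < ν) (hμ : 0 < μ)
    {c : (Fin d → ℤ) → ℝ} {F F' : ℝ → Torus d → ℝ}
    (hF : MemLp (fun p : ℝ × Torus d => F p.1 p.2) 2 (cyl d s T))
    (hF' : MemLp (fun p : ℝ × Torus d => F' p.1 p.2) 2 (cyl d s T))
    {G G' : ℝ → Torus d → Vec d}
    (hG : MemLp (fun p : ℝ × Torus d => G p.1 p.2) 2 (cyl d s T))
    (hG' : MemLp (fun p : ℝ × Torus d => G' p.1 p.2) 2 (cyl d s T))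
    (hGc : ∀ i k, ∀ᵐ r ∂(volume.restrict (Icc s T)), coef (fun x => G r x i) k =
        -(2 * Real.pi * k i) *
          duhamel (ν * eig (-k) + μ) s (c (-k)) (fun r => coef (F r) (-k)) r)
    (hGc' : ∀ i k, ∀ᵐ r ∂(volume.restrict (Icc s T)), coef (fun x => G' r x i) k =
        -(2 * Real.pi * k i) *
          duhamel (ν * eig (-k) + μ) s (c (-k)) (fun r => coef (F' r) (-k)) r) :
    ∑ i, ∫ p, (G p.1 p.2 i - G' p.1 p.2 i) ^ 2 ∂(cyl d s T) ≤
      (4 * ν * μ)⁻¹ * ∫ p, (F p.1 p.2 - F' p.1 p.2) ^ 2 ∂(cyl d s T) := by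
  have hcF : ∀ k, ∀ᵐ r ∂(volume.restrict (Icc s T)),
      coef (fun x => F r x - F' r x) k = coef (F r) k - coef (F' r) k := fun k => by
    filter_upwards [ae_memLp_two_slice hF, ae_memLp_two_slice hF'] with r h1 h2
    exact coef_sub h1 h2 k
  have hFF : MemLp (fun p : ℝ × Torus d => F p.1 p.2 - F' p.1 p.2) 2 (cyl d s T) := hF.sub hF'
  have hR := (hasSum_integral_coef_sq (F := fun r x => F r x - F' r x) hFF).mul_left (4 * ν * μ)⁻¹
  have hL := hasSum_sum fun i (_ : i ∈ Finset.univ) => hasSum_integral_coef_sq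
    (F := fun r x => G r x i - G' r x i) ((hG.component i).sub (hG'.component i))
  rw [← (Equiv.neg (Fin d → ℤ)).hasSum_iff] at hL
  refine hasSum_le (fun k => ?_) hL hR
  simp only [Function.comp, Equiv.neg_apply]
  set δ : ℝ → ℝ := duhamel (ν * eig k + μ) s 0 (fun r => coef (F r) k - coef (F' r) k)
  have hδ : ∀ i, ∫ r in Icc s T, coef (fun x => G r x i - G' r x i) (-k) ^ 2 =
      (2 * Real.pi * k i) ^ 2 * ∫ r in Icc s T, δ r ^ 2 := fun i => by
    rw [← integral_const_mul]
    refine integral_congr_ae ?_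
    filter_upwards [hGc i (-k), hGc' i (-k), ae_memLp_two_slice_component hG,
      ae_memLp_two_slice_component hG', ae_restrict_mem measurableSet_Icc] with r h1 h2 h3 h4 hr
    rw [coef_sub (h3 i) (h4 i), h1, h2, neg_neg, ← mul_sub, duhamel_sub hsT
      (intervalIntegrable_of_memLp hsT (memLp_coef hF k))
      (intervalIntegrable_of_memLp hsT (memLp_coef hF' k)) _ _ _ hr, sub_self, mul_pow]
    simp [δ]
  simp_rw [hδ]
  rw [← Finset.sum_mul]
  change eig k * _ ≤ _
  have he := eig_nonneg k
  have ha : 0 < ν * eig k + μ := by positivity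
  have h1 := integral_duhamel_sq_le hsT ((memLp_coef hF k).sub (memLp_coef hF' k)) ha 0
  have h2 : ∫ r in Icc s T, coef (fun x => F r x - F' r x) k ^ 2 =
      ∫ r in Icc s T, (coef (F r) k - coef (F' r) k) ^ 2 :=
    integral_congr_ae ((hcF k).mono fun r hr => by simp only [hr])
  rw [h2]
  simp only [Pi.sub_apply] at h1
  set Y := ∫ r in Icc s T, δ r ^ 2
  set Z := ∫ r in Icc s T, (coef (F r) k - coef (F' r) k) ^ 2
  have hZ0 : 0 ≤ Z := integral_nonneg fun r => sq_nonneg _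
  have h3 : (ν * eig k + μ) * Y ≤ (ν * eig k + μ)⁻¹ * Z := by
    simpa [δ] using! h1
  rw [le_inv_mul_iff₀ ha] at h3
  rw [le_inv_mul_iff₀ (by positivity)]
  refine le_trans ?_ h3
  have hY0 : 0 ≤ Y := integral_nonneg fun r => sq_nonneg _
  nlinarith [mul_nonneg (sq_nonneg (ν * eig k - μ)) hY0]

/-- The fixed point problem whose solution is the transport term. -/
lemma exists_fixedPoint (hsT : s ≤ T) {ν : ℝ} (hν : 0 < ν) {v : ℝ → Torus d → Vec d}
    (hv : MemLp (fun p : ℝ × Torus d => v p.1 p.2) ∞ (cyl d s T))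
    {c : (Fin d → ℤ) → ℝ} (hc : Summable fun k => c k ^ 2) :
    ∃ μ : ℝ, 0 < μ ∧ ∃ G : ℝ → Torus d → Vec d,
      MemLp (fun p : ℝ × Torus d => G p.1 p.2) 2 (cyl d s T) ∧
      ∀ i k, ∀ᵐ r ∂(volume.restrict (Icc s T)), coef (fun x => G r x i) k =
        -(2 * Real.pi * k i) * duhamel (ν * eig (-k) + μ) s (c (-k))
          (fun r => -coef (fun x => ⟪v r x, G r x⟫_ℝ) (-k)) r := by
  obtain ⟨M, hM0, hM⟩ := exists_ae_norm_le hv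
  -- The squared distances contract by `M² / (4 ν μ) = M² / (4 (M² + 1)) ≤ 1/4`, whatever the length
  -- of the interval. The `1` keeps `μ` positive when `M = 0`.
  set μ : ℝ := (M ^ 2 + 1) / ν with hμdef
  have hμ : 0 < μ := by positivity
  have hF : ∀ F : Lp ℝ 2 (cyl d s T),
      MemLp (fun p : ℝ × Torus d => (fun r x => F (r, x)) p.1 p.2) 2 (cyl d s T) :=
    fun F => Lp.memLp F
  choose G hG hGc using fun F : Lp ℝ 2 (cyl d s T) => exists_heat_grad hsT hν hμ hc
    (F := fun r x => F (r, x)) (hF F)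
  have hΨ : ∀ F, MemLp (fun p : ℝ × Torus d => -⟪v p.1 p.2, G F p.1 p.2⟫_ℝ) 2 (cyl d s T) :=
    fun F => (hv.inner_vec (hG F)).neg
  -- The unknown is the source `F` itself: solve the damped heat equation with source `F`, then
  -- return the transport term `-v · G F` of its gradient.
  set Ψ : Lp ℝ 2 (cyl d s T) → Lp ℝ 2 (cyl d s T) := fun F => (hΨ F).toLp _ with hΨdef
  have hlip : ∀ F F', dist (Ψ F) (Ψ F') ≤ (1 / 2 : NNReal) * dist F F' := by
    intro F F'
    rw [dist_eq_norm, dist_eq_norm]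
    refine (sq_le_sq₀ (norm_nonneg _) (by positivity)).1 ?_
    rw [hΨdef, norm_toLp_sub_sq, mul_pow, norm_sq_eq_integral]
    have h1 := heat_grad_contraction hsT hν hμ (hF F) (hF F') (hG F) (hG F') (hGc F) (hGc F')
    have hi : ∀ i, Integrable (fun p : ℝ × Torus d => (G F p.1 p.2 i - G F' p.1 p.2 i) ^ 2)
        (cyl d s T) := fun i => (((hG F).component i).sub ((hG F').component i)).integrable_sq
    have h2 : ∫ p, (-⟪v p.1 p.2, G F p.1 p.2⟫_ℝ - -⟪v p.1 p.2, G F' p.1 p.2⟫_ℝ) ^ 2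
        ∂(cyl d s T) ≤ M ^ 2 * ∑ i, ∫ p, (G F p.1 p.2 i - G F' p.1 p.2 i) ^ 2 ∂(cyl d s T) := by
      rw [← integral_finsetSum _ fun i _ => hi i, ← integral_const_mul]
      refine integral_mono_ae ((hΨ F).sub (hΨ F')).integrable_sq
        ((integrable_finsetSum _ fun i _ => hi i).const_mul _) ?_
      filter_upwards [hM] with p hp
      have e1 : -⟪v p.1 p.2, G F p.1 p.2⟫_ℝ - -⟪v p.1 p.2, G F' p.1 p.2⟫_ℝ =
          -⟪v p.1 p.2, G F p.1 p.2 - G F' p.1 p.2⟫_ℝ := by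
        rw [inner_sub_right]; ring
      have e2 : ∑ i, (G F p.1 p.2 i - G F' p.1 p.2 i) ^ 2 = ‖G F p.1 p.2 - G F' p.1 p.2‖ ^ 2 := by
        rw [EuclideanSpace.norm_sq_eq]
        simp
      simp only [e1, e2, neg_sq, ← mul_pow]
      refine sq_le_sq' ?_ ?_
      · have := neg_le_of_abs_le (abs_real_inner_le_norm (v p.1 p.2) (G F p.1 p.2 - G F' p.1 p.2))
        nlinarith [norm_nonneg (G F p.1 p.2 - G F' p.1 p.2)]
      · have := le_of_abs_le (abs_real_inner_le_norm (v p.1 p.2) (G F p.1 p.2 - G F' p.1 p.2))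
        nlinarith [norm_nonneg (G F p.1 p.2 - G F' p.1 p.2)]
    have h3 : ∫ p, ((F - F' : Lp ℝ 2 (cyl d s T)) p) ^ 2 ∂(cyl d s T) =
        ∫ p, (F (p.1, p.2) - F' (p.1, p.2)) ^ 2 ∂(cyl d s T) := by
      refine integral_congr_ae ?_
      filter_upwards [Lp.coeFn_sub F F'] with p hp
      rw [hp, Pi.sub_apply]
    rw [h3]
    set Z := ∫ p, (F (p.1, p.2) - F' (p.1, p.2)) ^ 2 ∂(cyl d s T)
    have hZ : 0 ≤ Z := integral_nonneg fun p => sq_nonneg _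
    refine h2.trans ((mul_le_mul_of_nonneg_left h1 (sq_nonneg M)).trans ?_)
    have h4 : M ^ 2 * (4 * ν * μ)⁻¹ ≤ 1 / 4 := by
      have : 4 * ν * μ = 4 * (M ^ 2 + 1) := by
        rw [hμdef]; field_simp
      rw [this, ← div_eq_mul_inv, div_le_div_iff₀ (by positivity) (by norm_num)]
      linarith
    have h5 := mul_le_mul_of_nonneg_right h4 hZ
    have h6 : ((1 / 2 : NNReal) : ℝ) ^ 2 = 1 / 4 := by norm_num
    rw [h6]
    linarith
  have hcontr : ContractingWith (1 / 2 : NNReal) Ψ :=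
    ⟨by norm_num, LipschitzWith.of_dist_le_mul hlip⟩
  obtain ⟨F, hfix, -⟩ := hcontr.exists_fixedPoint 0 (edist_ne_top _ _)
  refine ⟨μ, hμ, G F, hG F, fun i k => ?_⟩
  have h1 : ∀ᵐ p ∂(cyl d s T), F p = -⟪v p.1 p.2, G F p.1 p.2⟫_ℝ := by
    have h2 := (hΨ F).coeFn_toLp
    have h3 : (hΨ F).toLp _ = F := hfix
    rw [h3] at h2
    exact h2
  have h4 : ∀ᵐ r ∂(volume.restrict (Icc s T)),
      coef (fun x => F (r, x)) (-k) = -coef (fun x => ⟪v r x, G F r x⟫_ℝ) (-k) := by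
    filter_upwards [Measure.ae_ae_of_ae_prod h1] with r hr
    rw [coef_congr hr]
    simpa using coef_const_mul (-1) (fun x => ⟪v r x, G F r x⟫_ℝ) (-k)
  filter_upwards [hGc F i k, ae_restrict_mem measurableSet_Icc] with r h5 hr
  rw [h5, duhamel_congr h4 _ _ hr]

end Existence

/-! ### Existence of weak solutions on closed and half-open intervals. -/

section Solutions

variable {d : ℕ} {s T : ℝ}

lemma IsPrimitive.congr {y h y' h' : ℝ → ℝ} (H : IsPrimitive y h s T) (hsT : s ≤ T)
    (hy : EqOn y y' (Icc s T)) (hh : EqOn h h' (Icc s T)) : IsPrimitive y' h' s T := by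
  refine ⟨H.integrable.congr fun r hr => hh ?_, fun t ht => ?_⟩
  · rw [uIoc_of_le hsT] at hr
    exact Ioc_subset_Icc_self hr
  · rw [← hy ht, ← hy (left_mem_Icc.2 hsT), H.eq t ht]
    congr 1
    refine intervalIntegral.integral_congr fun r hr => hh ?_
    rw [uIcc_of_le ht.1] at hr
    exact ⟨hr.1, hr.2.trans ht.2⟩

lemma memLp_exp_smul {G : ℝ → Torus d → Vec d} (μ : ℝ)
    (hG : MemLp (fun p : ℝ × Torus d => G p.1 p.2) 2 (cyl d s T)) :
    MemLp (fun p : ℝ × Torus d => Real.exp (μ * (p.1 - s)) • G p.1 p.2) 2 (cyl d s T) := by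
  have hc : Continuous fun r : ℝ => Real.exp (μ * (r - s)) := by fun_prop
  obtain ⟨C, hC⟩ := isCompact_Icc.exists_bound_of_continuousOn (hc.continuousOn (s := Icc s T))
  have hm : ∀ᵐ p ∂(cyl d s T), p.1 ∈ Icc s T :=
    Measure.quasiMeasurePreserving_fst.ae (ae_restrict_mem measurableSet_Icc)
  have he : MemLp (fun p : ℝ × Torus d => Real.exp (μ * (p.1 - s))) ∞ (cyl d s T) :=
    memLp_top_of_bound (hc.comp continuous_fst).aestronglyMeasurable C
      (hm.mono fun p hp => hC _ hp)
  exact MemLp.smul (p := ∞) (q := 2) hG he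

lemma L20_ext {a b : L20 d} (h : ∀ k, coef a.1 k = coef b.1 k) : a = b :=
  Subtype.ext (Lp.ext (ae_eq_of_coef_eq (memLp_coe a) (memLp_coe b) h))

/-- Existence of weak solutions. -/
lemma exists_solution (hsT : s ≤ T) {ν : ℝ} (hν : 0 < ν) {v : ℝ → Torus d → Vec d}
    (hv : IsFlow v s T) (θ₀ : L20 d) : ∃ θ : ℝ → L20 d, IsSolution v ν s T θ ∧ θ s = θ₀ := by
  have hc : Summable fun k => coef θ₀.1 k ^ 2 := (hasSum_coef_sq θ₀).summable
  obtain ⟨μ, hμ, G, hG, hGc⟩ := exists_fixedPoint hsT hν hv.memLp hc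
  -- The exponential factor removes the artificial damping `μ`.
  set g : ℝ → Torus d → Vec d := fun r x => Real.exp (μ * (r - s)) • G r x with hgdef
  have hg : MemLp (fun p : ℝ × Torus d => g p.1 p.2) 2 (cyl d s T) := memLp_exp_smul μ hG
  set f : (Fin d → ℤ) → ℝ → ℝ := fun k r => -coef (fun x => ⟪v r x, G r x⟫_ℝ) k with hf
  have hfm : ∀ k, MemLp (f k) 2 (volume.restrict (Icc s T)) := fun k =>
    (memLp_coef (F := fun r x => ⟪v r x, G r x⟫_ℝ) (hv.memLp.inner_vec hG) k).neg
  set f' : (Fin d → ℤ) → ℝ → ℝ := fun k r => -coef (fun x => ⟪v r x, g r x⟫_ℝ) k with hf'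
  have hff' : ∀ k r, f' k r = Real.exp (μ * (r - s)) * f k r := fun k r => by
    simp only [hf', hf, hgdef, inner_smul_right, coef_const_mul]
    ring
  have hfm' : ∀ k, MemLp (f' k) 2 (volume.restrict (Icc s T)) := fun k =>
    (memLp_coef (F := fun r x => ⟪v r x, g r x⟫_ℝ) (hv.memLp.inner_vec hg) k).neg
  set Θ : (Fin d → ℤ) → ℝ → ℝ := fun k => duhamel (ν * eig k) s (coef θ₀.1 k) (f' k) with hΘ
  have hΘexp : ∀ k t, Θ k t =
      Real.exp (μ * (t - s)) * duhamel (ν * eig k + μ) s (coef θ₀.1 k) (f k) t := fun k t => by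
    rw [exp_mul_duhamel, hΘ]
    simp only [← hff']
  have hgc : ∀ i k, ∀ᵐ r ∂(volume.restrict (Icc s T)),
      coef (fun x => g r x i) k = -(2 * Real.pi * k i) * Θ (-k) r := fun i k => by
    filter_upwards [hGc i k] with r hr
    simp only [hgdef, PiLp.smul_apply, smul_eq_mul, coef_const_mul, hr, hΘexp]
    ring
  -- A summable majorant of the squared modes, uniform in time; it gives membership in `L²` at every
  -- time and continuity in time.
  set b : (Fin d → ℤ) → ℝ := fun k => Real.exp (μ * (T - s)) ^ 2 *
    (coef θ₀.1 k ^ 2 + μ⁻¹ * ∫ r in Icc s T, f k r ^ 2) with hb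
  have hbs : Summable b := by
    refine (hc.add (Summable.mul_left _ ?_)).mul_left _
    have := (hasSum_integral_coef_sq (F := fun r x => ⟪v r x, G r x⟫_ℝ)
      (hv.memLp.inner_vec hG)).summable
    simpa only [hf, neg_sq] using this
  have hle : ∀ t ∈ Icc s T, ∀ k, Θ k t ^ 2 ≤ b k := by
    intro t ht k
    have he := eig_nonneg k
    have ha : 0 < ν * eig k + μ := by positivity
    have h1 := duhamel_sq_le (hfm k) ha (coef θ₀.1 k) ht
    have h2 : (ν * eig k + μ)⁻¹ ≤ μ⁻¹ :=
      inv_anti₀ hμ (le_add_of_nonneg_left (mul_nonneg hν.le he))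
    have h3 := mul_le_mul_of_nonneg_right h2
      (integral_nonneg (μ := volume.restrict (Icc s T)) fun r => sq_nonneg (f k r))
    have h4 : Real.exp (μ * (t - s)) ^ 2 ≤ Real.exp (μ * (T - s)) ^ 2 := by
      have := ht.2
      gcongr
    rw [hΘexp, mul_pow]
    exact mul_le_mul h4 (h1.trans (by gcongr)) (sq_nonneg _) (sq_nonneg _)
  have hex : ∀ t ∈ Icc s T, ∃ w : Lp ℝ 2 (dx d), ∀ k, coef w k = Θ k t := fun t ht =>
    exists_coef_eq (Summable.of_nonneg_of_le (fun k => sq_nonneg _) (hle t ht) hbs)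
  -- The forcing of the zero mode is `-∫ v · ∇θ`, which vanishes for divergence-free `v`. Hence the
  -- mean stays zero and the solution stays in `L20`.
  have h0 : ∀ᵐ r ∂(volume.restrict (Icc s T)), f' 0 r = 0 := by
    filter_upwards [ae_restrict_mem measurableSet_Icc, hv.divFree, ae_memLp_top_slice hv.memLp,
      ae_memLp_two_slice_component hg,
      ae_all_iff.2 fun i => ae_all_iff.2 fun k => hgc i k] with r hr h1 h2 h3 h4
    obtain ⟨w, hw⟩ := hex r hr
    have h5 : HasWeakGrad w (g r) := hasWeakGrad_of_coef (Lp.memLp w) h3 fun i k => by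
      rw [hw, h4]
    have h6 := h1.integral_inner_eq_zero
      (fun i => (h2.component i).mono_exponent le_top) h3 h5
    simp only [hf', coef_zero, h6, neg_zero]
  have hzero : ∀ t ∈ Icc s T, Θ 0 t = 0 := by
    intro t ht
    have h1 : coef θ₀.1 0 = 0 := by
      rw [coef_zero]
      exact θ₀.2
    simp only [hΘ, h1]
    rw [duhamel_congr (g := fun _ => 0) h0 _ _ ht]
    simp [duhamel]
  have hex' : ∀ t, ∃ w : L20 d, t ∈ Icc s T → ∀ k, coef w.1 k = Θ k t := by
    intro t
    by_cases ht : t ∈ Icc s T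
    · obtain ⟨w, hw⟩ := hex t ht
      refine ⟨⟨w, ?_⟩, fun _ => hw⟩
      change ∫ x, w x ∂(dx d) = 0
      rw [← coef_zero, hw, hzero t ht]
    · exact ⟨0, fun h => absurd h ht⟩
  choose θ hθ using hex'
  have hpr : ∀ k, IsPrimitive (Θ k) (fun r => -(ν * eig k) * Θ k r + f' k r) s T := fun k =>
    isPrimitive_duhamel hsT _ _ (intervalIntegrable_of_memLp hsT (hfm' k))
  refine ⟨θ, isSolution_of_modes hv.memLp hg (continuousOn_of_coef hbs (fun k => ?_) ?_) ?_
    fun k => ?_, L20_ext fun k => ?_⟩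
  · exact (hpr k).continuousOn.congr fun t ht => hθ t ht k
  · intro t ht k
    rw [hθ t ht]
    exact hle t ht k
  · intro i k
    filter_upwards [hgc i k, ae_restrict_mem measurableSet_Icc] with r h1 hr
    rw [h1, hθ r hr]
  · refine (hpr k).congr hsT (fun t ht => (hθ t ht k).symm) fun t ht => ?_
    simp only [hθ t ht k, hf']
  · rw [hθ s (left_mem_Icc.2 hsT), hΘ]
    exact duhamel_self _ _ _ _

lemma IsSolution.congr {v : ℝ → Torus d → Vec d} {ν : ℝ} {θ η : ℝ → L20 d} (hsT : s ≤ T)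
    (hθ : IsSolution v ν s T θ) (h : EqOn θ η (Icc s T)) : IsSolution v ν s T η := by
  obtain ⟨hc, g, hg, hgrad, hw⟩ := hθ
  refine ⟨hc.congr h.symm, g, hg, ?_, fun ψ hψ t ht => ?_⟩
  · filter_upwards [hgrad, ae_restrict_mem measurableSet_Icc] with r h1 hr
    rwa [← h hr]
  · rw [← h ht, ← h (left_mem_Icc.2 hsT)]
    exact hw ψ hψ t ht

/-- Existence of weak solutions on a half-open time interval. -/
lemma exists_solution_Ico {a b : ℝ} {ν : ℝ} (hν : 0 < ν) {v : ℝ → Torus d → Vec d}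
    (hv : ∀ T ∈ Ico a b, IsFlow v a T) (θ₀ : L20 d) (hab : a < b) :
    ∃ θ : ℝ → L20 d, (∀ T ∈ Ico a b, IsSolution v ν a T θ) ∧ θ a = θ₀ := by
  have hex : ∀ T, ∃ θ : ℝ → L20 d, T ∈ Ico a b → IsSolution v ν a T θ ∧ θ a = θ₀ := by
    intro T
    by_cases hT : T ∈ Ico a b
    · obtain ⟨θ, hθ⟩ := exists_solution hT.1 hν (hv T hT) θ₀
      exact ⟨θ, fun _ => hθ⟩
    · exact ⟨0, fun h => absurd h hT⟩
  choose Θ hΘ using hex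
  -- The value at `t` is taken from the solution on `[a,t]`. By uniqueness it agrees with the
  -- solution on any longer interval.
  refine ⟨fun t => Θ t t, fun T hT => ?_, (hΘ a (left_mem_Ico.2 hab)).2⟩
  refine (hΘ T hT).1.congr hT.1 fun t ht => ?_
  have ht' : t ∈ Ico a b := ⟨ht.1, ht.2.trans_lt hT.2⟩
  exact ((hΘ T hT).1.mono (hv T hT) le_rfl ht.2).eq_of_eq hν.le (hΘ t ht').1 (hv t ht')
    ((hΘ T hT).2.trans (hΘ t ht').2.symm) (right_mem_Icc.2 ht.1)

end Solutions

/-! ### Construction of the time change. -/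

section Clock

open scoped Manifold

/-- A smooth function that is constant, equal to `lam n`, around the middle of `[n,n+1]`. -/
lemma exists_smooth_plateaus {lam : ℕ → ℝ} (hlam : ∀ n, 1 ≤ lam n) :
    ∃ q : ℝ → ℝ, ContDiff ℝ ∞ q ∧ (∀ y, 1 ≤ q y) ∧
      ∀ n : ℕ, ∀ y ∈ Icc (n + 1 / 4 : ℝ) (n + 3 / 4), q y = lam n := by
  -- The admissible values at each point form a convex set, so locally constant choices can be
  -- patched by a smooth partition of unity.
  set t : ℝ → Set ℝ := fun y => {c | 1 ≤ c ∧ ∀ n : ℕ, n + 1 / 4 ≤ y → y ≤ n + 3 / 4 → c = lam n}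
  have hconv : ∀ y, Convex ℝ (t y) := by
    rintro y c ⟨h1, h2⟩ c' ⟨h1', h2'⟩ a b ha hb hab
    simp only [smul_eq_mul]
    refine ⟨by nlinarith, fun n hn hn' => ?_⟩
    rw [h2 n hn hn', h2' n hn hn', ← add_mul, hab, one_mul]
  have hloc : ∀ y : ℝ, ∃ c : ℝ, ∀ᶠ z in 𝓝 y, c ∈ t z := by
    intro y
    rcases lt_or_ge y (1 / 4) with hy | hy
    · refine ⟨1, (gt_mem_nhds hy).mono fun z hz => ⟨le_rfl, fun n hn _ => ?_⟩⟩
      have : (0 : ℝ) ≤ n := n.cast_nonneg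
      linarith
    · have h1 := Nat.floor_le (show 0 ≤ y by linarith)
      have h2 := Nat.lt_floor_add_one y
      set n := ⌊y⌋₊
      -- Away from the integers, `lam n` is admissible on all of `(n, n+1)`. Near an integer no
      -- plateau is present, so any value at least `1` will do.
      rcases h1.lt_or_eq with h3 | h3
      · refine ⟨lam n, ((lt_mem_nhds h3).and (gt_mem_nhds h2)).mono fun z hz =>
          ⟨hlam n, fun m hm hm' => ?_⟩⟩
        have h4 : (n : ℝ) < ((m + 1 : ℕ) : ℝ) := by push_cast; linarith [hz.1]
        have h5 : (m : ℝ) < ((n + 1 : ℕ) : ℝ) := by push_cast; linarith [hz.2]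
        rw [Nat.cast_lt] at h4 h5
        rw [show m = n by omega]
      · have h4 : y < n + 1 / 4 := by linarith
        have h5 : (n : ℝ) - 1 / 4 < y := by linarith
        refine ⟨1, ((lt_mem_nhds h5).and (gt_mem_nhds h4)).mono fun z hz =>
          ⟨le_rfl, fun m hm hm' => ?_⟩⟩
        exfalso
        have h6 : (m : ℝ) < n := by linarith [hz.2]
        rw [Nat.cast_lt] at h6
        have h7 : ((m + 1 : ℕ) : ℝ) ≤ n := by exact_mod_cast h6
        push_cast at h7
        linarith [hz.1]
  obtain ⟨g, hg⟩ := exists_contMDiffMap_forall_mem_convex_of_local_const (n := ⊤) 𝓘(ℝ, ℝ)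
    hconv hloc
  exact ⟨g, g.contMDiff.contDiff, fun y => (hg y).1, fun n y hy => (hg y).2 n hy.1 hy.2⟩

/-- The beginning of the `n`-th time interval. -/
noncomputable def startTime (n : ℕ) : ℝ := 1 - 1 / (n + 1 / 4)

/-- The end of the `n`-th time interval. -/
noncomputable def endTime (n : ℕ) : ℝ := 1 - 1 / (n + 3 / 4)

lemma startTime_nonneg {n : ℕ} (hn : 1 ≤ n) : 0 ≤ startTime n := by
  have : (1 : ℝ) ≤ n := by exact_mod_cast hn
  rw [startTime, sub_nonneg, div_le_one (by linarith)]
  linarith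

lemma endTime_lt_one (n : ℕ) : endTime n < 1 := by
  rw [endTime]
  have : (0 : ℝ) < 1 / (n + 3 / 4) := by positivity
  linarith

lemma le_endTime_sub_startTime (n : ℕ) :
    1 / (2 * (n + 1 : ℝ) ^ 2) ≤ endTime n - startTime n := by
  have hn : (0 : ℝ) ≤ n := n.cast_nonneg
  have e : endTime n - startTime n = 1 / (2 * ((n + 1 / 4) * (n + 3 / 4))) := by
    rw [endTime, startTime]
    field_simp
    ring
  rw [e]
  refine one_div_le_one_div_of_le (by positivity) ?_
  nlinarith

lemma startTime_lt_endTime (n : ℕ) : startTime n < endTime n := by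
  have h := le_endTime_sub_startTime n
  have : (0 : ℝ) < 1 / (2 * (n + 1 : ℝ) ^ 2) := by positivity
  linarith

lemma tendsto_startTime : Tendsto startTime atTop (𝓝 1) := by
  have h : Tendsto (fun n : ℕ => 1 / ((n : ℝ) + 1 / 4)) atTop (𝓝 0) :=
    tendsto_const_nhds.div_atTop (tendsto_atTop_add_const_right _ _ tendsto_natCast_atTop_atTop)
  have h1 := h.const_sub 1
  rw [sub_zero] at h1
  exact h1

/-- A time change from `[0,1)` to `[0,∞)` that is affine, with prescribed slopes `lam n`, on
the intervals `[startTime n, endTime n]`. -/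
lemma exists_clock {lam : ℕ → ℝ} (hlam : ∀ n, 1 ≤ lam n)
    (hgrow : ∀ n : ℕ, n ≤ lam n * (endTime n - startTime n)) :
    ∃ σ : ℝ → ℝ, IsIncreasingDiffeo σ ∧ ∀ n, 1 ≤ n → ∀ t ∈ Icc (startTime n) (endTime n),
      derivWithin σ (Ico 0 1) t = lam n ∧ σ t = σ (startTime n) + lam n * (t - startTime n) := by
  obtain ⟨q, hq, hq1, hqn⟩ := exists_smooth_plateaus hlam
  -- Under `t ↦ 1 / (1 - t)` the interval `[startTime n, endTime n]` becomes the plateau `[n + 1/4,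
  -- n + 3/4]`, so `p` is constant there.
  set p : ℝ → ℝ := fun t => q (1 / (1 - t)) with hp
  have hpc : ContDiffOn ℝ ∞ p (Iio 1) := by
    refine hq.comp_contDiffOn (contDiffOn_const.div (contDiffOn_const.sub contDiffOn_id) ?_)
    intro t ht
    have : t < 1 := ht
    exact (sub_pos.2 this).ne'
  have hp1 : ∀ t, 1 ≤ p t := fun t => hq1 _
  have hpn : ∀ n, 1 ≤ n → ∀ t ∈ Icc (startTime n) (endTime n), p t = lam n := by
    intro n hn t ht
    have hn0 : (1 : ℝ) ≤ n := by exact_mod_cast hn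
    have h1 : t < 1 := ht.2.trans_lt (endTime_lt_one n)
    have h2 : 0 < 1 - t := by linarith
    refine hqn n _ ⟨?_, ?_⟩
    · have := ht.1
      rw [startTime] at this
      rw [le_div_iff₀ h2]
      have h3 : 1 - t ≤ 1 / (n + 1 / 4) := by linarith
      rw [le_div_iff₀ (by linarith)] at h3
      linarith
    · have := ht.2
      rw [endTime] at this
      rw [div_le_iff₀ h2]
      have h3 : 1 / (n + 3 / 4) ≤ 1 - t := by linarith
      rw [div_le_iff₀ (by linarith)] at h3
      linarith
  have hint : ∀ a b, a < 1 → b < 1 → IntervalIntegrable p volume a b := fun a b ha hb =>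
    (hpc.continuousOn.mono fun t ht => by
      rcases le_total a b with h | h
      · rw [uIcc_of_le h] at ht; exact ht.2.trans_lt hb
      · rw [uIcc_of_ge h] at ht; exact ht.2.trans_lt ha).intervalIntegrable
  -- The clock is built on the open half-line `(-∞, 1)`, which it maps onto `ℝ`. Inversion then
  -- takes place between open sets, and the endpoint `0` enters only by restriction at the end.
  set σ : ℝ → ℝ := fun t => ∫ r in (0 : ℝ)..t, p r with hσ
  have hd : ∀ t < 1, HasDerivAt σ (p t) t := fun t ht =>
    intervalIntegral.integral_hasDerivAt_right (hint 0 t one_pos ht)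
      (hpc.continuousOn.stronglyMeasurableAtFilter isOpen_Iio t ht)
      (hpc.continuousOn.continuousAt (isOpen_Iio.mem_nhds ht))
  have hdiff : ∀ a b, a < 1 → b < 1 → σ b - σ a = ∫ r in a..b, p r := fun a b ha hb =>
    intervalIntegral.integral_interval_sub_left (hint 0 b one_pos hb) (hint 0 a one_pos ha)
  have hlow : ∀ a b, a ≤ b → b < 1 → b - a ≤ σ b - σ a := fun a b hab hb => by
    rw [hdiff a b (hab.trans_lt hb) hb]
    have := intervalIntegral.integral_mono_on hab (intervalIntegrable_const (c := (1 : ℝ)))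
      (hint a b (hab.trans_lt hb) hb) fun t _ => hp1 t
    simpa using this
  have hmono : StrictMonoOn σ (Iio 1) := fun a _ b hb hab => by
    have := hlow a b hab.le hb
    linarith
  have hσ0 : σ 0 = 0 := intervalIntegral.integral_same
  have haff : ∀ n, 1 ≤ n → ∀ t ∈ Icc (startTime n) (endTime n),
      σ t = σ (startTime n) + lam n * (t - startTime n) := by
    intro n hn t ht
    have ht1 := ht.2.trans_lt (endTime_lt_one n)
    have h1 := hdiff (startTime n) t (ht.1.trans_lt ht1) ht1
    have h2 : ∫ r in startTime n..t, p r = ∫ _ in startTime n..t, lam n := by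
      refine intervalIntegral.integral_congr fun r hr => hpn n hn r ?_
      rw [uIcc_of_le ht.1] at hr
      exact ⟨hr.1, hr.2.trans ht.2⟩
    rw [h2, intervalIntegral.integral_const, smul_eq_mul] at h1
    linarith
  have hcd : ContDiffOn ℝ ∞ σ (Iio 1) := by
    rw [contDiffOn_infty_iff_deriv_of_isOpen isOpen_Iio]
    exact ⟨fun t ht => (hd t ht).differentiableAt.differentiableWithinAt,
      hpc.congr fun t ht => (hd t ht).deriv⟩
  have hcont : ContinuousOn σ (Iio 1) := hcd.continuousOn
  -- Upwards, `hgrow` makes `σ` advance by at least `n` on the `n`-th interval; downwards, slope at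
  -- least `1` suffices.
  have hsurj : ∀ y, ∃ t ∈ Iio (1 : ℝ), σ t = y := by
    intro y
    obtain ⟨n, hn⟩ := exists_nat_ge (max y 1)
    have hn1 : 1 ≤ n := by
      have : (1 : ℝ) ≤ n := (le_max_right _ _).trans hn
      exact_mod_cast this
    have hb := endTime_lt_one n
    have hab := startTime_lt_endTime n
    have h0 := startTime_nonneg hn1
    have h1 : y ≤ σ (endTime n) := by
      have e1 := haff n hn1 _ (right_mem_Icc.2 hab.le)
      have e2 := hlow 0 (startTime n) h0 (hab.trans hb)
      have e3 := hgrow n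
      have e4 := (le_max_left y 1).trans hn
      linarith
    have h2 : σ (min y 0) ≤ y := by
      have := hlow (min y 0) 0 (min_le_right _ _) one_pos
      have := min_le_left y 0
      linarith
    have h3 : min y 0 ≤ endTime n := (min_le_right _ _).trans (h0.trans hab.le)
    obtain ⟨t, ht, hty⟩ := intermediate_value_Icc h3
      (hcont.mono fun t ht => ht.2.trans_lt hb) ⟨h2, h1⟩
    exact ⟨t, ht.2.trans_lt hb, hty⟩
  choose ρ hρ1 hρ using hsurj
  have hleft : ∀ t ∈ Iio (1 : ℝ), ρ (σ t) = t := fun t ht =>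
    hmono.injOn (hρ1 _) ht (hρ _)
  have hρmono : StrictMono ρ := fun y z hyz => by
    rw [← hmono.lt_iff_lt (hρ1 y) (hρ1 z), hρ, hρ]
    exact hyz
  have hρc : Continuous ρ := by
    rw [continuous_iff_continuousAt]
    intro y
    refine (hρmono.strictMonoOn univ).continuousAt_of_image_mem_nhds univ_mem ?_
    rw [image_univ]
    exact mem_of_superset (isOpen_Iio.mem_nhds (hρ1 y)) fun t ht => ⟨σ t, hleft t ht⟩
  -- The inverse of a smooth local homeomorphism is smooth where the derivative is nonzero, and here
  -- it is at least `1`.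
  let e : OpenPartialHomeomorph ℝ ℝ :=
    { toFun := σ, invFun := ρ, source := Iio 1, target := univ
      map_source' := fun _ _ => mem_univ _, map_target' := fun y _ => hρ1 y
      left_inv' := hleft, right_inv' := fun y _ => hρ y
      open_source := isOpen_Iio, open_target := isOpen_univ
      continuousOn_toFun := hcont, continuousOn_invFun := hρc.continuousOn }
  have hρcd : ContDiff ℝ ∞ ρ := by
    rw [contDiff_iff_contDiffAt]
    intro y
    exact e.contDiffAt_symm_deriv (f₀' := p (ρ y)) (by linarith [hp1 (ρ y)]) (mem_univ y)
      (hd _ (hρ1 y)) (hcd.contDiffAt (isOpen_Iio.mem_nhds (hρ1 y)))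
  have hsub : Ico (0 : ℝ) 1 ⊆ Iio 1 := fun t ht => ht.2
  have hmaps : MapsTo σ (Ico 0 1) (Ici 0) := fun t ht => by
    have := hlow 0 t ht.1 ht.2
    have := ht.1
    change 0 ≤ σ t
    linarith
  have hmaps' : ∀ y ∈ Ici (0 : ℝ), ρ y ∈ Ico (0 : ℝ) 1 := fun y hy => by
    refine ⟨?_, hρ1 y⟩
    have h1 : ρ 0 = 0 := by
      have := hleft 0 (mem_Iio.2 (one_pos : (0 : ℝ) < 1))
      rwa [hσ0] at this
    rw [← h1]
    exact hρmono.monotone hy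
  refine ⟨σ, ⟨⟨hmaps, (hmono.mono hsub).injOn, fun y hy => ⟨ρ y, hmaps' y hy, hρ y⟩⟩,
    hmono.mono hsub, hcd.mono hsub, ρ, ⟨fun t ht => hleft t (hsub ht), fun y _ => hρ y⟩,
    hρcd.contDiffOn⟩, fun n hn t ht => ⟨?_, haff n hn t ht⟩⟩
  have ht' : t ∈ Ico (0 : ℝ) 1 :=
    ⟨(startTime_nonneg hn).trans ht.1, ht.2.trans_lt (endTime_lt_one n)⟩
  rw [(hd t ht'.2).hasDerivWithinAt.derivWithin (uniqueDiffOn_Ico 0 1 t ht'), hpn n hn t ht]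

end Clock

/-! ### The accelerated flow and affine changes of time. -/

section Acceleration

variable {d : ℕ}

/-- Almost-everywhere properties of `u` pass to `u ∘ σ` because the differentiable inverse `ρ` maps
null sets to null sets. The indicator provides measurability on the whole line, as nothing is known
of `σ` outside `[0,1)`. -/
lemma IsIncreasingDiffeo.quasiMeasurePreserving {σ : ℝ → ℝ} (hσ : IsIncreasingDiffeo σ) {T : ℝ}
    (hT : T ∈ Ico (0 : ℝ) 1) :
    Measure.QuasiMeasurePreserving ((Icc 0 T).indicator σ) (volume.restrict (Icc 0 T))
      (volume.restrict (Icc 0 (σ T))) := by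
  obtain ⟨hbij, hmono, hsm, ρ, hinv, hρ⟩ := hσ
  have hsub : Icc 0 T ⊆ Ico (0 : ℝ) 1 := fun t ht => ⟨ht.1, ht.2.trans_lt hT.2⟩
  have hmeas : Measurable ((Icc 0 T).indicator σ) := by
    have h1 := (hsm.continuousOn.mono hsub).measurable_piecewise (g := fun _ => (0 : ℝ))
      continuousOn_const measurableSet_Icc
    rw [← piecewise_eq_indicator]
    exact h1
  refine ⟨hmeas, Measure.AbsolutelyContinuous.mk fun N hN h0 => ?_⟩
  rw [Measure.restrict_apply hN] at h0
  rw [Measure.map_apply hmeas hN, Measure.restrict_apply (hmeas hN)]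
  have himg : volume (ρ '' (N ∩ Icc 0 (σ T))) = 0 :=
    addHaar_image_eq_zero_of_differentiableOn_of_addHaar_eq_zero volume
      ((hρ.differentiableOn (by simp)).mono fun y hy => hy.2.1) h0
  refine measure_mono_null (fun t ht => ?_) himg
  have ht2 := ht.2
  have ht1 : σ t ∈ N := by simpa [indicator_of_mem ht2] using ht.1
  exact ⟨σ t, ⟨ht1, hbij.mapsTo (hsub ht2), hmono.monotoneOn (hsub ht2) hT ht2.2⟩,
    hinv.1 (hsub ht2)⟩

lemma WeakDivFree.const_smul {v : Torus d → Vec d} (h : WeakDivFree v) (c : ℝ) :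
    WeakDivFree fun x => c • v x := fun ψ hψ => by
  simp only [real_inner_smul_left]
  rw [integral_const_mul, h ψ hψ, mul_zero]

/-- The accelerated flow is bounded and divergence-free on compact subintervals of `[0,1)`. -/
lemma isFlow_accelerate {u : ℝ → Torus d → Vec d} (hu : LocBounded u) (hdiv : DivFree u)
    {σ : ℝ → ℝ} (hσ : IsIncreasingDiffeo σ) {s T : ℝ} (hs : 0 ≤ s) (hT : T ∈ Ico s 1) :
    IsFlow (accelerate σ u) s T := by
  suffices h : IsFlow (accelerate σ u) 0 T from h.mono (Icc_subset_Icc_left hs)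
  have hT0 : T ∈ Ico (0 : ℝ) 1 := ⟨hs.trans hT.1, hT.2⟩
  have hq := hσ.quasiMeasurePreserving hT0
  have hsub : Icc 0 T ⊆ Ico (0 : ℝ) 1 := fun t ht => ⟨ht.1, ht.2.trans_lt hT.2⟩
  have hder : ContinuousOn (derivWithin σ (Ico 0 1)) (Icc 0 T) :=
    (hσ.2.2.1.continuousOn_derivWithin (uniqueDiffOn_Ico 0 1) (by simp)).mono hsub
  have hind : ∀ t ∈ Icc 0 T, (Icc 0 T).indicator σ t = σ t := fun t ht => indicator_of_mem ht σ
  constructor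
  · obtain ⟨M, hM0, hM⟩ := exists_ae_norm_le (hu (σ T))
    obtain ⟨C, hC⟩ := isCompact_Icc.exists_bound_of_continuousOn hder
    have hqp := QuasiMeasurePreserving.prodMap hq (Measure.QuasiMeasurePreserving.id (dx d))
    have hmem : ∀ᵐ p ∂(cyl d 0 T), p.1 ∈ Icc 0 T :=
      Measure.quasiMeasurePreserving_fst.ae (ae_restrict_mem measurableSet_Icc)
    have hmeas : AEStronglyMeasurable (fun p : ℝ × Torus d =>
        derivWithin σ (Ico 0 1) p.1 • u ((Icc 0 T).indicator σ p.1) p.2) (cyl d 0 T) :=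
      ((hder.aestronglyMeasurable measurableSet_Icc).comp_fst).smul
        ((hu (σ T)).1.comp_quasiMeasurePreserving hqp)
    refine memLp_top_of_bound (hmeas.congr ?_) (C * M) ?_
    · filter_upwards [hmem] with p hp
      rw [hind p.1 hp]
      rfl
    · filter_upwards [hmem, hqp.ae hM] with p hp hp'
      simp only [Prod.map, id, hind p.1 hp] at hp'
      rw [accelerate, norm_smul]
      exact mul_le_mul (hC _ hp) hp' (norm_nonneg _) ((norm_nonneg _).trans (hC _ hp))
  · have h1 : ∀ᵐ y ∂(volume.restrict (Icc 0 (σ T))), WeakDivFree (u y) :=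
      ae_restrict_of_ae_restrict_of_subset Icc_subset_Ici_self hdiv
    filter_upwards [hq.ae h1, ae_restrict_mem measurableSet_Icc] with t ht ht'
    rw [hind t ht'] at ht
    exact ht.const_smul _

/-- The inverse clock contracts lengths by `l`, whence the factor on the target measure. It
transports square-integrability of the gradient. -/
lemma measurePreserving_affine {a A l : ℝ} (hl : 0 < l) (b : ℝ) :
    MeasurePreserving (fun y => l⁻¹ * y + (a - l⁻¹ * A))
      (volume.restrict (Icc A (A + l * (b - a)))) (ENNReal.ofReal l • volume.restrict (Icc a b)) := by
  have hm : Measurable fun y : ℝ => l⁻¹ * y + (a - l⁻¹ * A) := by fun_prop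
  have hmap : Measure.map (fun y : ℝ => l⁻¹ * y + (a - l⁻¹ * A)) volume =
      ENNReal.ofReal l • volume := by
    have h1 : (fun y : ℝ => l⁻¹ * y + (a - l⁻¹ * A)) =
        (fun y => y + (a - l⁻¹ * A)) ∘ fun y => l⁻¹ * y := rfl
    rw [h1, ← Measure.map_map (by fun_prop) (by fun_prop),
      Real.map_volume_mul_left (inv_pos.2 hl).ne', Measure.map_smul, map_add_right_eq_self]
    simp [abs_of_pos hl]
  refine ⟨hm, ?_⟩
  rw [← Measure.restrict_smul, ← hmap, Measure.restrict_map hm measurableSet_Icc]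
  congr 2
  ext y
  simp only [mem_Icc, mem_preimage]
  have e : l⁻¹ * y + (a - l⁻¹ * A) = a + (y - A) / l := by
    field_simp; ring
  rw [e]
  have h1 : a ≤ a + (y - A) / l ↔ A ≤ y := by
    rw [le_add_iff_nonneg_right, le_div_iff₀ hl]
    constructor <;> intro h <;> linarith
  have h2 : a + (y - A) / l ≤ b ↔ y ≤ A + l * (b - a) := by
    rw [← le_sub_iff_add_le', div_le_iff₀ hl]
    constructor <;> intro h <;> linarith
  rw [h1, h2]

/-- An affine change of time turns the flow `l • u` with diffusivity `ν` into the flow `u` with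
diffusivity `ν / l`. -/
lemma IsSolution.timeChange {u v : ℝ → Torus d → Vec d} {ν a b A l : ℝ} {θ : ℝ → L20 d}
    (hl : 0 < l) (hθ : IsSolution v ν a b θ)
    (hv : ∀ r ∈ Icc a b, ∀ x, v r x = l • u (A + l * (r - a)) x) :
    IsSolution u (ν / l) A (A + l * (b - a)) (fun y => θ (l⁻¹ * y + (a - l⁻¹ * A))) := by
  obtain ⟨hc, g, hg, hgrad, hw⟩ := hθ
  set φ : ℝ → ℝ := fun y => l⁻¹ * y + (a - l⁻¹ * A) with hφ
  have hmp := measurePreserving_affine (a := a) (A := A) hl b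
  have hφA : φ A = a := by simp [hφ]
  have hφinv : ∀ y, A + l * (φ y - a) = y := fun y => by
    simp only [hφ]; field_simp; ring
  have hmaps : MapsTo φ (Icc A (A + l * (b - a))) (Icc a b) := by
    intro y hy
    have h := hφinv y
    constructor
    · have h1 : 0 ≤ l * (φ y - a) := by linarith [hy.1]
      linarith [nonneg_of_mul_nonneg_right h1 hl]
    · have h1 : l * (φ y - a) ≤ l * (b - a) := by linarith [hy.2]
      linarith [le_of_mul_le_mul_left h1 hl]
  have hq : Measure.QuasiMeasurePreserving φ (volume.restrict (Icc A (A + l * (b - a))))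
      (volume.restrict (Icc a b)) :=
    ⟨hmp.measurable, by
      rw [hmp.map_eq]
      exact Measure.AbsolutelyContinuous.rfl.smul_left _⟩
  have hmp2 : MeasurePreserving (Prod.map φ (id : Torus d → Torus d))
      (cyl d A (A + l * (b - a))) (ENNReal.ofReal l • cyl d a b) := by
    have := hmp.prod (MeasurePreserving.id (dx d))
    rwa [Measure.prod_smul_left] at this
  refine ⟨hc.comp (by fun_prop) hmaps, fun y => g (φ y), ?_, ?_, fun ψ hψ t ht => ?_⟩
  · exact (hg.smul_measure (c := ENNReal.ofReal l) ENNReal.ofReal_ne_top).comp_measurePreserving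
      hmp2
  · exact hq.ae hgrad
  · have h1 := hw ψ hψ (φ t) (hmaps ht)
    change (∫ x, (θ (φ t)).1 x * ψ x ∂(dx d)) - (∫ x, (θ (φ A)).1 x * ψ x ∂(dx d)) =
      ∫ r in A..t, ∫ x, (-(ν / l) * ⟪g (φ r) x, grad ψ x⟫_ℝ -
        ⟪u r x, g (φ r) x⟫_ℝ * ψ x) ∂(dx d)
    rw [hφA]
    refine h1.trans ?_
    set K : ℝ → ℝ := fun r => ∫ x, (-(ν / l) * ⟪g r x, grad ψ x⟫_ℝ -
      ⟪u (A + l * (r - a)) x, g r x⟫_ℝ * ψ x) ∂(dx d) with hK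
    have h2 : ∫ r in A..t, ∫ x, (-(ν / l) * ⟪g (φ r) x, grad ψ x⟫_ℝ -
        ⟪u r x, g (φ r) x⟫_ℝ * ψ x) ∂(dx d) = ∫ r in A..t, K (l⁻¹ * r + (a - l⁻¹ * A)) := by
      refine intervalIntegral.integral_congr fun r _ => ?_
      simp only [hK]
      have := hφinv r
      simp only [hφ] at this
      rw [this]
    -- The substitution produces a factor `l`, which turns `ν / l` into `ν` and `u` into `l • u =
    -- v`.
    have h3 := intervalIntegral.integral_comp_mul_add (a := A) (b := t) K (inv_pos.2 hl).ne'
      (a - l⁻¹ * A)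
    rw [h2, h3, inv_inv, smul_eq_mul, ← intervalIntegral.integral_const_mul]
    change ∫ r in a..φ t, _ = ∫ r in φ A..φ t, _
    rw [hφA]
    refine intervalIntegral.integral_congr fun r hr => ?_
    rw [uIcc_of_le (hmaps ht).1] at hr
    simp only [hK]
    rw [← integral_const_mul]
    refine integral_congr_ae (Eventually.of_forall fun x => ?_)
    simp only [hv r ⟨hr.1, hr.2.trans (hmaps ht).2⟩, real_inner_smul_left]
    field_simp

end Acceleration

/-! ### Choice of the slopes and decay of the norm. -/

section Dissipation

variable {d : ℕ}

/-- If `τ^u(ν / l) ≥ l δ`, then `(ν / l) τ^u(ν / l) ≥ ν δ ≥ δ / (n + 1)` for `ν ≥ 1/n`. Relaxation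
enhancement excludes this once `ν / l < r`, and `l ≥ (n + 1) / r` ensures that for all `ν ≤ n`
simultaneously. The bound `n ≤ l δ` makes the clock reach infinity. -/
lemma exists_slope {u : ℝ → Torus d → Vec d} (hre : RelaxationEnhancing u) (n : ℕ) {δ : ℝ}
    (hδ : 0 < δ) : ∃ l : ℝ, 1 ≤ l ∧ n ≤ l * δ ∧ ∀ ν : ℝ, 0 < ν → ν ≤ n → 1 ≤ ν * n →
      ∀ s : ℝ, 0 ≤ s → ∃ t, s ≤ t ∧ t - s < l * δ ∧ PhiNormLe u (ν / l) s t (1 / 2) := by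
  have hε : 0 < ENNReal.ofReal (δ / (n + 1)) := ENNReal.ofReal_pos.2 (by positivity)
  have hev := hre.eventually (gt_mem_nhds hε)
  rw [eventually_nhdsWithin_iff, Metric.eventually_nhds_iff] at hev
  obtain ⟨r, hr, hev⟩ := hev
  refine ⟨max 1 (max (n / δ) ((n + 1) / r)), le_max_left _ _, ?_, fun ν hν hνn hν1 s hs => ?_⟩
  · rw [← div_le_iff₀ hδ]
    exact (le_max_left _ _).trans (le_max_right _ _)
  set l : ℝ := max 1 (max (n / δ) ((n + 1) / r))
  have hl : 0 < l := one_pos.trans_le (le_max_left _ _)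
  have hlr : (n + 1 : ℝ) ≤ l * r := by
    rw [← div_le_iff₀ hr]
    exact (le_max_right _ _).trans (le_max_right _ _)
  have h1 : ν / l < r := by
    rw [div_lt_iff₀ hl]
    linarith
  have hνl : 0 < ν / l := by positivity
  have h2 := hev (y := ν / l) (by rwa [Real.dist_eq, sub_zero, abs_of_pos hνl]) hνl
  have h3 : dissipationTime u (ν / l) < ENNReal.ofReal (l * δ) := by
    by_contra hcon
    rw [not_lt] at hcon
    refine h2.not_ge ?_
    refine le_trans ?_ (mul_le_mul_right hcon _)
    rw [← ENNReal.ofReal_mul hνl.le]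
    refine ENNReal.ofReal_le_ofReal ?_
    have e : ν / l * (l * δ) = ν * δ := by field_simp
    rw [e, div_le_iff₀ (by positivity)]
    nlinarith
  have h4 : ⨅ t ∈ {t : ℝ | s ≤ t ∧ PhiNormLe u (ν / l) s t (1 / 2)}, ENNReal.ofReal (t - s) <
      ENNReal.ofReal (l * δ) :=
    lt_of_le_of_lt (le_iSup₂ (f := fun (s : ℝ) (_ : s ∈ Ici (0 : ℝ)) =>
      ⨅ t ∈ {t : ℝ | s ≤ t ∧ PhiNormLe u (ν / l) s t (1 / 2)}, ENNReal.ofReal (t - s)) s hs) h3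
  simp only [iInf_lt_iff] at h4
  obtain ⟨t, ⟨ht, hPhi⟩, hlt⟩ := h4
  exact ⟨t, ht, (ENNReal.ofReal_lt_ofReal_iff (by positivity)).1 hlt, hPhi⟩

lemma endTime_le_startTime_succ (n : ℕ) : endTime n ≤ startTime (n + 1) := by
  rw [endTime, startTime]
  push_cast
  have : 1 / ((n : ℝ) + 1 + 1 / 4) ≤ 1 / (n + 3 / 4) :=
    one_div_le_one_div_of_le (by positivity) (by linarith)
  linarith

/-- A decreasing quantity that is halved on all late intervals tends to zero. -/
lemma tendsto_zero_of_halving {f : ℝ → ℝ} {s : ℝ} {N : ℕ} (hf0 : ∀ t, 0 ≤ f t)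
    (hf : AntitoneOn f (Ico s 1)) (hN : ∀ n ≥ N, s ≤ startTime n)
    (hhalf : ∀ n ≥ N, f (endTime n) ≤ 1 / 2 * f (startTime n)) :
    Tendsto f (𝓝[<] 1) (𝓝 0) := by
  have hmem : ∀ n ≥ N, startTime n ∈ Ico s 1 ∧ endTime n ∈ Ico s 1 := fun n hn =>
    ⟨⟨hN n hn, (startTime_lt_endTime n).trans (endTime_lt_one n)⟩,
      (hN n hn).trans (startTime_lt_endTime n).le, endTime_lt_one n⟩
  have hgeo : ∀ j : ℕ, f (startTime (N + j)) ≤ (1 / 2) ^ j * f (startTime N) := by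
    intro j
    induction j with
    | zero => simp
    | succ j ih =>
      have h1 := hf (hmem (N + j) (by omega)).2 (hmem (N + j + 1) (by omega)).1
        (endTime_le_startTime_succ (N + j))
      have h2 := hhalf (N + j) (by omega)
      rw [pow_succ, ← add_assoc]
      linarith
  have hlim : Tendsto (fun j : ℕ => (1 / 2 : ℝ) ^ j * f (startTime N)) atTop (𝓝 0) := by
    simpa using (tendsto_pow_atTop_nhds_zero_of_lt_one (by norm_num : (0 : ℝ) ≤ 1 / 2)
      (by norm_num)).mul_const (f (startTime N))
  rw [Metric.tendsto_nhds]
  intro ε hε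
  obtain ⟨j, hj⟩ := (hlim.eventually (gt_mem_nhds hε)).exists
  have hm := (hmem (N + j) (by omega)).1
  filter_upwards [Ioo_mem_nhdsLT hm.2] with t ht
  rw [Real.dist_eq, sub_zero, abs_of_nonneg (hf0 t)]
  exact ((hf hm ⟨hm.1.trans ht.1.le, ht.2⟩ ht.1.le).trans (hgeo j)).trans_lt hj

/-- Solutions of the accelerated equation are halved on an interval on which the acceleration
is constant and large. -/
lemma norm_endTime_le {u : ℝ → Torus d → Vec d} {σ : ℝ → ℝ} {ν l : ℝ} {n : ℕ}
    {θ : ℝ → L20 d} (hν : 0 < ν) (hl : 0 < l)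
    (hflow : IsFlow (accelerate σ u) (startTime n) (endTime n))
    (hσ : ∀ t ∈ Icc (startTime n) (endTime n), derivWithin σ (Ico 0 1) t = l ∧
      σ t = σ (startTime n) + l * (t - startTime n))
    (hθ : IsSolution (accelerate σ u) ν (startTime n) (endTime n) θ)
    (hex : ∃ t, σ (startTime n) ≤ t ∧ t - σ (startTime n) < l * (endTime n - startTime n) ∧
      PhiNormLe u (ν / l) (σ (startTime n)) t (1 / 2)) :
    ‖θ (endTime n)‖ ≤ 1 / 2 * ‖θ (startTime n)‖ := by
  obtain ⟨t, ht, htl, hPhi⟩ := hex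
  set a := startTime n
  set b := endTime n
  set A := σ a
  -- The moment at which the clock shows `t`. The norm has been halved by then, and it cannot grow
  -- between `c` and `b`.
  set c : ℝ := l⁻¹ * t + (a - l⁻¹ * A) with hc
  have hct : A + l * (c - a) = t := by rw [hc]; field_simp; ring
  have hca : a ≤ c := by
    have h1 : 0 ≤ l * (c - a) := by linarith
    linarith [nonneg_of_mul_nonneg_right h1 hl]
  have hcb : c ≤ b := by
    have h1 : l * (c - a) ≤ l * (b - a) := by linarith
    linarith [le_of_mul_le_mul_left h1 hl]
  have h1 := (hθ.mono hflow le_rfl hcb).timeChange (u := u) (A := A) hl fun r hr x => by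
    obtain ⟨h2, h3⟩ := hσ r ⟨hr.1, hr.2.trans hcb⟩
    rw [accelerate, h2, h3]
  rw [hct] at h1
  have h2 := hPhi _ _ ⟨_, h1, rfl, rfl⟩
  have e : l⁻¹ * A + (a - l⁻¹ * A) = a := by ring
  rw [e] at h2
  exact (hθ.antitoneOn_norm hν.le hflow ⟨hca, hcb⟩ (right_mem_Icc.2 (hca.trans hcb)) hcb).trans h2

end Dissipation

end RelaxEnh

/-! ### Proof of the theorem. -/

theorem theorem1 (d : ℕ) (u : ℝ → RelaxEnh.Torus d → RelaxEnh.Vec d)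
    (hu : RelaxEnh.LocBounded u) (hdiv : RelaxEnh.DivFree u)
    (hre : RelaxEnh.RelaxationEnhancing u) :
    ∃ σ : ℝ → ℝ, RelaxEnh.IsIncreasingDiffeo σ ∧
      ∀ ν : ℝ, 0 < ν → ∀ s ∈ Ico (0 : ℝ) 1, ∀ θ₀ : RelaxEnh.L20 d,
        RelaxEnh.DissipatesTotally (RelaxEnh.accelerate σ u) ν s θ₀ := by
  choose lam hlam1 hgrow hlam using fun n => RelaxEnh.exists_slope hre n
    (sub_pos.2 (RelaxEnh.startTime_lt_endTime n))
  obtain ⟨σ, hσ, hσn⟩ := RelaxEnh.exists_clock hlam1 hgrow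
  refine ⟨σ, hσ, fun ν hν s hs θ₀ => ?_⟩
  have hflow : ∀ T ∈ Ico s 1, RelaxEnh.IsFlow (RelaxEnh.accelerate σ u) s T := fun T hT =>
    RelaxEnh.isFlow_accelerate hu hdiv hσ hs.1 hT
  refine ⟨RelaxEnh.exists_solution_Ico hν hflow θ₀ hs.2, fun θ hθ _ => ?_⟩
  -- From `N₁` on, `ν` lies in `[1/n, n]` and `n ≥ 1`, so that the interval lies in `[0,1)`; from
  -- `N₂` on, the intervals begin after `s`.
  obtain ⟨N₁, hN₁⟩ := exists_nat_ge (max 1 (max ν ν⁻¹))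
  obtain ⟨N₂, hN₂⟩ := eventually_atTop.1
    (RelaxEnh.tendsto_startTime.eventually (lt_mem_nhds hs.2))
  rw [tendsto_zero_iff_norm_tendsto_zero]
  refine RelaxEnh.tendsto_zero_of_halving (s := s) (N := max N₁ N₂) (fun t => norm_nonneg _)
    (fun t ht t' ht' htt' => ?_) (fun n hn => (hN₂ n ((le_max_right _ _).trans hn)).le)
    fun n hn => ?_
  · exact (hθ t' ht').antitoneOn_norm hν.le (hflow t' ht') ⟨ht.1, htt'⟩
      (right_mem_Icc.2 ht'.1) htt'
  · have hn1 : max 1 (max ν ν⁻¹) ≤ (n : ℝ) :=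
      hN₁.trans (by exact_mod_cast (le_max_left _ _).trans hn)
    have h1 : (1 : ℝ) ≤ n := (le_max_left _ _).trans hn1
    have h1' : 1 ≤ n := by exact_mod_cast h1
    have hνn : ν ≤ n := ((le_max_left _ _).trans (le_max_right _ _)).trans hn1
    have hνn' : ν⁻¹ ≤ n := ((le_max_right _ _).trans (le_max_right _ _)).trans hn1
    have hs' : s ≤ RelaxEnh.startTime n := (hN₂ n ((le_max_right _ _).trans hn)).le
    have hb : RelaxEnh.endTime n ∈ Ico s 1 :=
      ⟨hs'.trans (RelaxEnh.startTime_lt_endTime n).le, RelaxEnh.endTime_lt_one n⟩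
    have hσ0 : 0 ≤ σ (RelaxEnh.startTime n) := hσ.1.mapsTo
      ⟨RelaxEnh.startTime_nonneg h1', (RelaxEnh.startTime_lt_endTime n).trans hb.2⟩
    refine RelaxEnh.norm_endTime_le hν (one_pos.trans_le (hlam1 n))
      ((hflow _ hb).mono (Icc_subset_Icc_left hs')) (hσn n h1')
      ((hθ _ hb).mono (hflow _ hb) hs' le_rfl) (hlam n ν hν hνn ?_ _ hσ0)
    have := mul_le_mul_of_nonneg_left hνn' hν.le
    rwa [mul_inv_cancel₀ hν.ne'] at this
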